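/- **Setting.** Let $M\subset\mathbb R^n$ be open with coordinates $u=(u^1,\dots,u^n)$, let $0\le m\le n$, and let $N=\{u\in M: u^\alpha=0,\ \alpha=m+1,\dots,n\}$, with coordinates $u^1,\dots,u^m$. Capital indices run over $1,\dots,n$, small Latin indices over $1,\dots,m$, Greek indices over $m+1,\dots,n$; repeated indices are summed. $\mathcal L(M)$ is the space of smooth maps $S^1=\mathbb R/\mathbb Z\to M$, and $\mathcal L(N)\subset\mathcal L(M)$. A differential polynomial is a polynomial in the derivatives $\partial_x^j u^I$ ($j\ge1$) whose coefficients are smooth functions of $u$; $\partial_x^ju^I$ has degree $j$. A local functional is $\Phi[u]=\int_{S^1}f\,dx$ with $f$ a differential polynomial in $u(x)$; its variational derivative at $u$ is the smooth $\frac{\delta\Phi}{\delta u}$ on $S^1$ with $\frac{d}{dt}\big|_{t=0}\Phi[u+tv]=\int_{S^1}\frac{\delta\Phi}{\delta u^I}v^I\,dx$ for all smooth $v$ on $S^1$. Fix a real parameter $\epsilon\neq0$. A matrix differential operator of finite order is a matrix with entries the finite sums $$\sum_{k\ge-1}\epsilon^k\sum_{s=0}^{k+1}A_{k,s}(u(x))\,\frac{d^{\,k-s+1}}{dx^{\,k-s+1}},$$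 where $A_{k,s}$ is a homogeneous differential polynomial of degree $s$. Such an operator $\mathbb F^{IJ}$ defines a local Poisson bracket $\{u^I(x),u^J(y)\}=\mathbb F^{IJ}(u(x))\delta(x-y)$ on $\mathcal L(M)$ if $$\{\Phi,\Psi\}[u]=\int_{S^1}\frac{\delta\Phi}{\delta u^I}\,\mathbb F^{IJ}(u)\frac{\delta\Psi}{\delta u^J}\,dx$$ maps pairs of local functionals to local functionals and is bilinear and skew-symmetric and satisfies the Leibniz rule and the Jacobi identity; the same definitions apply to $\mathcal L(N)$. **Proposition 2.1 (Dirac reduction of local Poisson brackets).** Let $\mathbb F^{IJ}$ define a local Poisson bracket on $\mathcal L(M)$. Assume that the minor $\mathbb F^{\alpha\beta}$, restricted to $\mathcal L(N)$, has a two-sided inverse $\mathbb S_{\alpha\beta}$ which is a matrix differential operator of finite order on $\mathcal L(N)$. Then there is a matrix differential operator $\widetilde{\mathbb F}^{ij}$ of finite order on $\mathcal L(N)$ such that: 1. $\widetilde{\mathbb F}^{ij}=\mathbb F^{ij}-\mathbb F^{i\alpha}\,\mathbb S_{\alpha\beta}\,\mathbb F^{\beta j}$, where the entries of $\mathbb F$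 are restricted to $\mathcal L(N)$; 2. the Dirac reduction to $\mathcal L(N)$ is well defined and is given by $\widetilde{\mathbb F}$: for each local functional $\Phi$ on $\mathcal L(M)$ and each loop $u\in\mathcal L(N)$ there is exactly one family of smooth functions $C_\beta$ on $S^1$ with $\mathbb F^{\alpha J}\frac{\delta\Phi}{\delta u^J}+\mathbb F^{\alpha\beta}C_\beta=0$ for all $\alpha$, and for this family $$\mathbb F^{iJ}\frac{\delta\Phi}{\delta u^J}+\mathbb F^{i\beta}C_\beta=\widetilde{\mathbb F}^{ij}\,\frac{\delta(\Phi|_{\mathcal L(N)})}{\delta u^j};$$ 3. $\{u^i(x),u^j(y)\}_N=\widetilde{\mathbb F}^{ij}(u(x))\delta(x-y)$ defines a local Poisson bracket on $\mathcal L(N)$. -/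

import Mathlib

open scoped ContDiff

noncomputable section

namespace LocalPoisson

/-! Functions on the circle are 1-periodic functions on the line. -/

/-- Smooth maps from the circle `ℝ / ℤ` to `ℝ ^ I`. -/
def SmoothPeriodic {I : Type} [Fintype I] (φ : ℝ → I → ℝ) : Prop :=
  ContDiff ℝ ∞ φ ∧ Function.Periodic φ 1

/-- The loop space of a coordinate domain `U`: smooth maps from the circle to `U`. -/
def Loop {I : Type} [Fintype I] (U : Set (I → ℝ)) : Type :=
  {u : ℝ → I → ℝ // SmoothPeriodic u ∧ ∀ x, u x ∈ U}

/-- Smooth functions on the open set `U` (values outside `U` are irrelevant, and never used). -/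
def smoothFunctions {I : Type} [Fintype I] (U : Set (I → ℝ)) : Subring ((I → ℝ) → ℝ) where
  carrier := {a | ContDiffOn ℝ ∞ a U}
  mul_mem' ha hb := ContDiffOn.mul ha hb
  one_mem' := contDiffOn_const
  add_mem' ha hb := ContDiffOn.add ha hb
  zero_mem' := contDiffOn_const
  neg_mem' ha := ContDiffOn.neg ha

/-- Differential polynomials: polynomials in the derivatives of the coordinates, with
coefficients that are smooth functions on `U`. The variable `(j, i)` stands for the derivative
of order `j + 1` of the coordinate `u i`. -/
abbrev DiffPoly {I : Type} [Fintype I] (U : Set (I → ℝ)) : Type :=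
  MvPolynomial (ℕ × I) (smoothFunctions U)

/-- Homogeneity of degree `s`, when the derivative of order `j` of a coordinate has degree `j`
(and smooth functions of `u` have degree `0`). -/
def DiffPoly.IsHomogeneousOfDegree {I : Type} [Fintype I] {U : Set (I → ℝ)}
    (p : DiffPoly U) (s : ℕ) : Prop :=
  MvPolynomial.IsWeightedHomogeneous (fun v : ℕ × I => v.1 + 1) p s

/-- The value at the point `x` of the circle of a differential polynomial along a loop. -/
def DiffPoly.eval {I : Type} [Fintype I] {U : Set (I → ℝ)}
    (p : DiffPoly U) (u : Loop U) (x : ℝ) : ℝ :=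
  MvPolynomial.eval₂ ((Pi.evalRingHom (fun _ : I → ℝ => ℝ) (u.1 x)).comp (smoothFunctions U).subtype)
    (fun v : ℕ × I => iteratedDeriv (v.1 + 1) (fun y => u.1 y v.2) x) p

/-- A functional on the loop space is local if it is the integral over the circle of a
differential polynomial. -/
def IsLocalFunctional {I : Type} [Fintype I] {U : Set (I → ℝ)} (Φ : Loop U → ℝ) : Prop :=
  ∃ f : DiffPoly U, ∀ u : Loop U, Φ u = ∫ x in (0 : ℝ)..1, f.eval u x

/-- `g` is the variational derivative of `Φ` at the loop `u`: the first variation of `Φ` at `u`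
in every direction `v` is `∫ ∑ i, g i * v i`. For open `U` the loop `u + t v` stays in `U` for
small `t`, so the extension of `Φ` by zero off the loop space plays no role. -/
def HasVarDeriv {I : Type} [Fintype I] {U : Set (I → ℝ)} (Φ : Loop U → ℝ) (u : Loop U)
    (g : ℝ → I → ℝ) : Prop :=
  SmoothPeriodic g ∧ ∀ v : ℝ → I → ℝ, SmoothPeriodic v →
    HasDerivAt (fun t : ℝ => Function.extend Subtype.val Φ 0 (u.1 + t • v))
      (∫ x in (0 : ℝ)..1, ∑ i, g x i * v x i) 0

open Classical in
/-- The variational derivative `δΦ/δu` at the loop `u`, as a function on the circle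
(zero if there is none). -/
def varDeriv {I : Type} [Fintype I] {U : Set (I → ℝ)} (Φ : Loop U → ℝ) (u : Loop U) :
    ℝ → I → ℝ :=
  if h : ∃ g, HasVarDeriv Φ u g then h.choose else 0

/-- Matrix differential operators of finite order, with rows indexed by `R` and columns by `C`,
whose entries are finite sums
`∑ k ≥ -1, ε ^ k * ∑ s ≤ k + 1, A k s (u(x)) * (d/dx) ^ (k - s + 1)`
where `A k s` is a homogeneous differential polynomial of degree `s`.
The field `A` uses the shifted index `p = k + 1`, with `0 ≤ p ≤ top`. -/
structure LocalOperator (R C : Type) {I : Type} [Fintype I] (U : Set (I → ℝ)) where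
  top : ℕ
  A : ℕ → ℕ → R → C → DiffPoly U
  homogeneous : ∀ p s a b, (A p s a b).IsHomogeneousOfDegree s

/-- The action of the operator, at a loop `u`, on functions on the circle. -/
def LocalOperator.apply {R C I : Type} [Fintype C] [Fintype I] {U : Set (I → ℝ)}
    (F : LocalOperator R C U) (ε : ℝ) (u : Loop U) (φ : ℝ → C → ℝ) : ℝ → R → ℝ :=
  fun x a => ∑ b, ∑ p ∈ Finset.range (F.top + 1), ε ^ ((p : ℤ) - 1) *
    ∑ s ∈ Finset.range (p + 1), (F.A p s a b).eval u x * iteratedDeriv (p - s) (fun y => φ y b) x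

/-- The submatrix with the given rows and columns. -/
def LocalOperator.submatrix {R C R' C' I : Type} [Fintype I] {U : Set (I → ℝ)}
    (F : LocalOperator R C U) (f : R' → R) (g : C' → C) : LocalOperator R' C' U where
  top := F.top
  A p s a b := F.A p s (f a) (g b)
  homogeneous p s a b := F.homogeneous p s (f a) (g b)

/-- The bracket of functionals given by `{u i (x), u j (y)} = F i j (u(x)) δ(x - y)`. -/
def bracket {I : Type} [Fintype I] {U : Set (I → ℝ)} (ε : ℝ) (F : LocalOperator I I U)
    (Φ Ψ : Loop U → ℝ) : Loop U → ℝ :=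
  fun u => ∫ x in (0 : ℝ)..1, ∑ i, varDeriv Φ u x i * F.apply ε u (varDeriv Ψ u) x i

/-- `{u i (x), u j (y)} = F i j (u(x)) δ(x - y)` defines a local Poisson bracket on the loop space
of `U`: a bilinear skew-symmetric bracket on local functionals that satisfies the Leibniz rule and
the Jacobi identity. (A product of local functionals need not be local, but it has a variational
derivative, so its bracket with a local functional makes sense.) -/
structure IsLocalPoissonBracket {I : Type} [Fintype I] {U : Set (I → ℝ)} (ε : ℝ)
    (F : LocalOperator I I U) : Prop where
  isLocal : ∀ Φ Ψ : Loop U → ℝ, IsLocalFunctional Φ → IsLocalFunctional Ψ →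
    IsLocalFunctional (bracket ε F Φ Ψ)
  linear_left : ∀ (c : ℝ) (Φ Φ' Ψ : Loop U → ℝ), IsLocalFunctional Φ → IsLocalFunctional Φ' →
    IsLocalFunctional Ψ → bracket ε F (c • Φ + Φ') Ψ = c • bracket ε F Φ Ψ + bracket ε F Φ' Ψ
  linear_right : ∀ (c : ℝ) (Φ Ψ Ψ' : Loop U → ℝ), IsLocalFunctional Φ → IsLocalFunctional Ψ →
    IsLocalFunctional Ψ' → bracket ε F Φ (c • Ψ + Ψ') = c • bracket ε F Φ Ψ + bracket ε F Φ Ψ'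
  skew : ∀ Φ Ψ : Loop U → ℝ, IsLocalFunctional Φ → IsLocalFunctional Ψ →
    bracket ε F Φ Ψ = - bracket ε F Ψ Φ
  leibniz : ∀ Φ Ψ Ω : Loop U → ℝ, IsLocalFunctional Φ → IsLocalFunctional Ψ →
    IsLocalFunctional Ω → bracket ε F (Φ * Ψ) Ω = Φ * bracket ε F Ψ Ω + bracket ε F Φ Ω * Ψ
  jacobi : ∀ Φ Ψ Ω : Loop U → ℝ, IsLocalFunctional Φ → IsLocalFunctional Ψ →
    IsLocalFunctional Ω →
    bracket ε F (bracket ε F Φ Ψ) Ω + bracket ε F (bracket ε F Ψ Ω) Φ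
      + bracket ε F (bracket ε F Ω Φ) Ψ = 0

/-- The submanifold `N` of `U` on which the coordinates with index in `K` vanish, in the remaining
coordinates. -/
def slice {I K : Type} (U : Set (I ⊕ K → ℝ)) : Set (I → ℝ) :=
  {w | Sum.elim w 0 ∈ U}

/-- The inclusion of the loop space of `N` in the loop space of `U`. -/
def inclusion {I K : Type} [Fintype I] [Fintype K] {U : Set (I ⊕ K → ℝ)}
    (w : Loop (slice U)) : Loop U :=
  ⟨fun x => Sum.elim (w.1 x) 0, by
    refine ⟨⟨?_, ?_⟩, fun x => w.2.2 x⟩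
    · rw [contDiff_pi]
      rintro (i | k)
      · exact (contDiff_pi.1 w.2.1.1) i
      · exact contDiff_const
    · intro x
      simp only [w.2.1.2 x]⟩

/-- The right hand side of the Dirac equations: the Hamiltonian vector field of `Φ` at the loop
`u`, corrected by multipliers `c` for the constraints `u k = 0`, `k ∈ K`. -/
def diracField {I K : Type} [Fintype I] [Fintype K] {U : Set (I ⊕ K → ℝ)} (ε : ℝ)
    (F : LocalOperator (I ⊕ K) (I ⊕ K) U) (Φ : Loop U → ℝ) (u : Loop U) (c : ℝ → K → ℝ) :
    ℝ → I ⊕ K → ℝ :=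
  F.apply ε u (varDeriv Φ u) + (F.submatrix id Sum.inr).apply ε u c

/-- The Dirac reduction of `F` to the loop space of `N` is well defined, with reduced operator
`G`: for each local Hamiltonian on the loop space of `U`, at each loop in `N`, exactly one choice
of multipliers makes the corrected vector field tangent to the loop space of `N`, and
the vector field so obtained is the one that `G` assigns to the restricted Hamiltonian. -/
def IsDiracReduction {I K : Type} [Fintype I] [Fintype K] {U : Set (I ⊕ K → ℝ)} (ε : ℝ)
    (F : LocalOperator (I ⊕ K) (I ⊕ K) U) (G : LocalOperator I I (slice U)) : Prop :=
  ∀ Φ : Loop U → ℝ, IsLocalFunctional Φ → ∀ w : Loop (slice U),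
    (∃! c : ℝ → K → ℝ, SmoothPeriodic c ∧
      ∀ x k, diracField ε F Φ (inclusion w) c x (Sum.inr k) = 0) ∧
    ∀ c : ℝ → K → ℝ, SmoothPeriodic c →
      (∀ x k, diracField ε F Φ (inclusion w) c x (Sum.inr k) = 0) →
      ∀ x i, diracField ε F Φ (inclusion w) c x (Sum.inl i)
        = G.apply ε w (varDeriv (fun w' => Φ (inclusion w')) w) x i

/-- `S` is a (two-sided) inverse of the minor of `F` with rows and columns in `K`, restricted to
the loop space of `N`. -/
def IsInverseOfMinor {I K : Type} [Fintype I] [Fintype K] {U : Set (I ⊕ K → ℝ)} (ε : ℝ)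
    (F : LocalOperator (I ⊕ K) (I ⊕ K) U) (S : LocalOperator K K (slice U)) : Prop :=
  ∀ (w : Loop (slice U)) (φ : ℝ → K → ℝ), SmoothPeriodic φ →
    S.apply ε w ((F.submatrix Sum.inr Sum.inr).apply ε (inclusion w) φ) = φ ∧
    (F.submatrix Sum.inr Sum.inr).apply ε (inclusion w) (S.apply ε w φ) = φ

end LocalPoisson

end

namespace LocalPoisson

/-! At a loop in the slice, split a covector into a part `ψ` along the slice and a normal part `χ`.
Its Hamiltonian vector field is tangent to the slice iff `F_KI ψ + F_KK χ = 0`. Since `S` inverts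
`F_KK`, this means `χ = - S F_KI ψ` (`tangent_iff`), and the tangent component is then `(F_II - F_IK
S F_KI) ψ`. The variational derivative of a restricted functional is the `ψ`-part of the ambient one
(`HasVarDeriv.restrict`). The multipliers only shift `χ`, so the Dirac reduction is well defined and
given by this operator (`isDiracReduction`). It is a differential operator of the required form
because such operators are closed under composition, the total derivative raising the degree by one.

Locality, bilinearity and the Leibniz rule hold for the bracket of any differential operator.
Skew-symmetry and Jacobi are inherited from the ambient bracket. A local functional on the slice is
extended so that its normal variational derivative is the `χ` above (`exists_tangent_extension`).
This is possible because `S` is a differential operator: the prescribed normal derivative consists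
of differential polynomials `c k`, and adding `∑ u^k c k` to the density achieves it. The extension
then has a tangent Hamiltonian field, so the ambient bracket restricts to the reduced one
(`bracket_inclusion`), and the identities restrict as well. Coefficients are extended only near a
given loop, by a cutoff. That suffices, since the identities are checked at one loop and variational
derivatives are local. -/

/-- The jet at `x` of a curve: all derivatives of all coordinates. -/
noncomputable def jet {I : Type} (u : ℝ → I → ℝ) (x : ℝ) (j : ℕ) (i : I) : ℝ :=
  iteratedDeriv j (fun y => u y i) x

/-- Evaluation of differential polynomials on a jet. -/
noncomputable def jetEval {I : Type} [Fintype I] {U : Set (I → ℝ)} (J : ℕ → I → ℝ) :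
    DiffPoly U →+* ℝ :=
  MvPolynomial.eval₂Hom
    ((Pi.evalRingHom (fun _ : I → ℝ => ℝ) (J 0)).comp (smoothFunctions U).subtype)
    (fun v : ℕ × I => J (v.1 + 1) v.2)

/-! ### Differential polynomials as functions of jets -/

section Jets

lemma jet_zero {I : Type} (u : ℝ → I → ℝ) (x : ℝ) : jet u x 0 = u x := by
  funext i; simp [jet]

variable {I : Type} [Fintype I] {U : Set (I → ℝ)}

/-- Evaluation becomes a ring homomorphism whose argument is an arbitrary jet, which may then vary
with the point of the circle or with a variation parameter. -/
lemma eval_eq_jetEval (p : DiffPoly U) (u : Loop U) (x : ℝ) :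
    p.eval u x = jetEval (jet u.1 x) p := by
  simp only [jetEval, jet_zero]; rfl

@[simp] lemma jetEval_C (J : ℕ → I → ℝ) (a : smoothFunctions U) :
    jetEval J (MvPolynomial.C a : DiffPoly U) = a.1 (J 0) := by
  simp [jetEval]

@[simp] lemma jetEval_X (J : ℕ → I → ℝ) (v : ℕ × I) :
    jetEval J (MvPolynomial.X v : DiffPoly U) = J (v.1 + 1) v.2 := by
  simp [jetEval]

lemma SmoothPeriodic.contDiff_apply {φ : ℝ → I → ℝ} (h : SmoothPeriodic φ) (i : I) :
    ContDiff ℝ ∞ (fun y => φ y i) := contDiff_pi.1 h.1 i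

lemma contDiff_iteratedDeriv {f : ℝ → ℝ} (hf : ContDiff ℝ ∞ f) (j : ℕ) :
    ContDiff ℝ ∞ (iteratedDeriv j f) := by
  induction j with
  | zero => simpa using hf
  | succ j ih =>
    rw [iteratedDeriv_succ]
    exact (contDiff_infty_iff_deriv.1 ih).2

lemma periodic_deriv {f : ℝ → ℝ} (hf : Function.Periodic f 1) :
    Function.Periodic (deriv f) 1 := by
  intro x
  rw [← deriv_comp_add_const]
  congr 1
  funext y
  exact hf y

lemma periodic_iteratedDeriv {f : ℝ → ℝ} (hf : Function.Periodic f 1) (j : ℕ) :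
    Function.Periodic (iteratedDeriv j f) 1 := by
  induction j with
  | zero => simpa using hf
  | succ j ih => rw [iteratedDeriv_succ]; exact periodic_deriv ih

lemma hasDerivAt_iteratedDeriv {f : ℝ → ℝ} (hf : ContDiff ℝ ∞ f) (j : ℕ) (x : ℝ) :
    HasDerivAt (iteratedDeriv j f) (iteratedDeriv (j + 1) f x) x := by
  rw [iteratedDeriv_succ]
  exact (((contDiff_iteratedDeriv hf j).differentiable (by simp)) x).hasDerivAt

lemma hasDerivAt_jet {u : ℝ → I → ℝ} (hu : SmoothPeriodic u) (j : ℕ) (i : I) (x : ℝ) :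
    HasDerivAt (fun y => jet u y j i) (jet u x (j + 1) i) x :=
  hasDerivAt_iteratedDeriv (hu.contDiff_apply i) j x

lemma contDiff_jet {u : ℝ → I → ℝ} (hu : SmoothPeriodic u) (j : ℕ) (i : I) :
    ContDiff ℝ ∞ (fun y => jet u y j i) :=
  contDiff_iteratedDeriv (hu.contDiff_apply i) j

lemma periodic_jet {u : ℝ → I → ℝ} (hu : SmoothPeriodic u) : Function.Periodic (jet u) 1 := by
  intro x
  funext j i
  exact periodic_iteratedDeriv (f := fun y => u y i) (fun y => congrFun (hu.2 y) i) j x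

lemma jet_add_smul {u v : ℝ → I → ℝ} (hu : SmoothPeriodic u) (hv : SmoothPeriodic v) (t x : ℝ) :
    jet (u + t • v) x = jet u x + t • jet v x := by
  funext j i
  have h1 := (hu.contDiff_apply i).of_le (m := j) (by exact_mod_cast le_top)
  have h2 := (hv.contDiff_apply i).of_le (m := j) (by exact_mod_cast le_top)
  have := iteratedDeriv_add (n := j) (x := x) h1.contDiffAt (h2.const_smul t).contDiffAt
  simp only [jet, Pi.add_apply, Pi.smul_apply] at this ⊢
  rw [← iteratedDeriv_fun_const_smul_field t (fun y => v y i)]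
  exact this

/-- The parameter space is arbitrary so that the lemma yields both smoothness in `x` and joint
regularity in `(t, x)`, needed to differentiate under the integral. -/
lemma jetEval_contDiffOn {E : Type} [NormedAddCommGroup E] [NormedSpace ℝ E] {s : Set E}
    {J : E → ℕ → I → ℝ} (hJ : ∀ j i, ContDiffOn ℝ ∞ (fun e => J e j i) s)
    (hs : ∀ e ∈ s, J e 0 ∈ U) (p : DiffPoly U) :
    ContDiffOn ℝ ∞ (fun e => jetEval (J e) p) s := by
  induction p using MvPolynomial.induction_on with
  | C a =>
    simp only [jetEval_C]
    exact ContDiffOn.comp (t := U) a.2 (contDiffOn_pi.2 fun i => hJ 0 i) hs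
  | add p q hp hq => simpa only [map_add] using hp.add hq
  | mul_X p v hp => simpa only [map_mul, jetEval_X] using hp.mul (hJ _ _)

/-- The functions `b i` are the partial derivatives of `a`; openness of `U` makes them smooth on
`U`. -/
lemma exists_coeff_deriv (hU : IsOpen U) (a : smoothFunctions U) :
    ∃ b : I → smoothFunctions U, ∀ (Y : ℝ → I → ℝ) (Y' : I → ℝ) (t : ℝ), Y t ∈ U →
      HasDerivAt Y Y' t → HasDerivAt (fun t => a.1 (Y t)) (∑ i, (b i).1 (Y t) * Y' i) t := by
  classical
  have ha : ContDiffOn ℝ ∞ a.1 U := a.2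
  refine ⟨fun i => ⟨fun y => fderiv ℝ a.1 y (fun j => if i = j then 1 else 0), ?_⟩, ?_⟩
  · exact (ha.fderiv_of_isOpen hU (by simp)).clm_apply contDiffOn_const
  · intro Y Y' t ht hY
    have h := ((ha.contDiffAt (hU.mem_nhds ht)).differentiableAt (by simp)).hasFDerivAt
    have := h.comp_hasDerivAt t hY
    refine HasDerivAt.congr_deriv this ?_
    rw [← ContinuousLinearMap.coe_coe, LinearMap.pi_apply_eq_sum_univ]
    exact Finset.sum_congr rfl fun i _ => by simp [mul_comm]

/-- The chain rule for differential polynomials evaluated along a curve of jets. -/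
lemma exists_chain_rule (hU : IsOpen U) (p : DiffPoly U) :
    ∃ (N : ℕ) (P : ℕ → I → DiffPoly U), ∀ M ≥ N, ∀ (J : ℝ → ℕ → I → ℝ) (J' : ℕ → I → ℝ) (t : ℝ),
      J t 0 ∈ U → (∀ j i, HasDerivAt (fun t => J t j i) (J' j i) t) →
      HasDerivAt (fun t => jetEval (J t) p)
        (∑ j ∈ Finset.range M, ∑ i, jetEval (J t) (P j i) * J' j i) t := by
  classical
  -- The formula is claimed for every `M ≥ N` so that the expansions of two polynomials can be cut
  -- off at a common order.
  induction p using MvPolynomial.induction_on with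
  | C a =>
    obtain ⟨b, hb⟩ := exists_coeff_deriv hU a
    refine ⟨1, fun j i => if j = 0 then MvPolynomial.C (b i) else 0, ?_⟩
    intro M hM J J' t ht hJ
    have := hb (fun t => J t 0) (J' 0) t ht (hasDerivAt_pi.2 (hJ 0))
    simp only [jetEval_C]
    convert this using 1
    rw [Finset.sum_eq_single 0]
    · simp
    · intro j _ hj; simp [hj]
    · intro h; simp at h; omega
  | add p q hp hq =>
    obtain ⟨N, P, hP⟩ := hp
    obtain ⟨N', Q, hQ⟩ := hq
    refine ⟨max N N', P + Q, ?_⟩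
    intro M hM J J' t ht hJ
    have := (hP M (le_trans (le_max_left _ _) hM) J J' t ht hJ).add
      (hQ M (le_trans (le_max_right _ _) hM) J J' t ht hJ)
    simp only [map_add, Pi.add_apply, add_mul, Finset.sum_add_distrib]
    exact this
  | mul_X p v hp =>
    obtain ⟨N, P, hP⟩ := hp
    refine ⟨max N (v.1 + 2), fun j i => P j i * MvPolynomial.X v +
      if j = v.1 + 1 then (if i = v.2 then p else 0) else 0, ?_⟩
    intro M hM J J' t ht hJ
    have := (hP M (le_trans (le_max_left _ _) hM) J J' t ht hJ).mul (hJ (v.1 + 1) v.2)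
    simp only [map_mul, jetEval_X, map_add, add_mul, Finset.sum_add_distrib]
    refine HasDerivAt.congr_deriv this ?_
    simp only [Finset.sum_mul]
    congr 1
    · exact Finset.sum_congr rfl fun j _ => Finset.sum_congr rfl fun i _ => by ring
    · rw [Finset.sum_eq_single (v.1 + 1), Finset.sum_eq_single v.2]
      · simp
      · intro i _ hi; simp [hi]
      · simp
      · intro j _ hj; simp [hj]
      · intro h; simp at h; omega

lemma eval_contDiff (p : DiffPoly U) (u : Loop U) : ContDiff ℝ ∞ (fun x => p.eval u x) := by
  simp only [eval_eq_jetEval]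
  rw [← contDiffOn_univ]
  refine jetEval_contDiffOn (fun j i => (contDiff_jet u.2.1 j i).contDiffOn) (fun x _ => ?_) p
  rw [jet_zero]; exact u.2.2 x

lemma eval_periodic (p : DiffPoly U) (u : Loop U) : Function.Periodic (fun x => p.eval u x) 1 := by
  intro x
  simp only [eval_eq_jetEval, periodic_jet u.2.1 x]

lemma smoothPeriodic_iff {φ : ℝ → I → ℝ} : SmoothPeriodic φ ↔
    ∀ i, ContDiff ℝ ∞ (fun x => φ x i) ∧ Function.Periodic (fun x => φ x i) 1 := by
  refine ⟨fun h i => ⟨h.contDiff_apply i, fun x => congrFun (h.2 x) i⟩, fun h => ⟨?_, ?_⟩⟩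
  · exact contDiff_pi.2 fun i => (h i).1
  · intro x; funext i; exact (h i).2 x

lemma smoothPeriodic_eval {A : Type} [Fintype A] (g : A → DiffPoly U) (u : Loop U) :
    SmoothPeriodic (fun x i => (g i).eval u x) :=
  smoothPeriodic_iff.2 fun i => ⟨eval_contDiff (g i) u, eval_periodic (g i) u⟩

lemma exists_deriv_eval (hU : IsOpen U) (p : DiffPoly U) :
    ∃ q : DiffPoly U, ∀ (u : Loop U) (x : ℝ), deriv (fun x => p.eval u x) x = q.eval u x := by
  obtain ⟨N, P, hP⟩ := exists_chain_rule hU p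
  refine ⟨∑ j ∈ Finset.range N, ∑ i, P j i * MvPolynomial.X (j, i), fun u x => ?_⟩
  simp only [eval_eq_jetEval, map_sum, map_mul, jetEval_X]
  refine (hP N le_rfl (jet u.1) (jet u.1 x <| · + 1) x ?_ fun j i => hasDerivAt_jet u.2.1 j i x).deriv
  rw [jet_zero]; exact u.2.2 x

lemma exists_iteratedDeriv_eval (hU : IsOpen U) (p : DiffPoly U) (j : ℕ) :
    ∃ q : DiffPoly U, ∀ (u : Loop U) (x : ℝ),
      iteratedDeriv j (fun x => p.eval u x) x = q.eval u x := by
  induction j with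
  | zero => exact ⟨p, fun u x => by simp⟩
  | succ j ih =>
    obtain ⟨q, hq⟩ := ih
    obtain ⟨r, hr⟩ := exists_deriv_eval hU q
    refine ⟨r, fun u x => ?_⟩
    rw [iteratedDeriv_succ, ← hr u x]
    congr 1
    funext y; exact hq u y

/-! Graded version of the calculus of differential polynomials. -/

/-- `g` is given by a homogeneous differential polynomial of degree `s`. -/
def IsDiffPoly (s : ℕ) (g : Loop U → ℝ → ℝ) : Prop :=
  ∃ p : DiffPoly U, p.IsHomogeneousOfDegree s ∧ ∀ u x, g u x = p.eval u x

lemma IsDiffPoly.contDiff {s : ℕ} {g : Loop U → ℝ → ℝ} (h : IsDiffPoly s g) (u : Loop U) :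
    ContDiff ℝ ∞ (g u) := by
  obtain ⟨p, _, hp⟩ := h
  rw [funext (hp u)]; exact eval_contDiff p u

lemma IsDiffPoly.zero (s : ℕ) : IsDiffPoly (U := U) s (fun _ _ => 0) :=
  ⟨0, MvPolynomial.isWeightedHomogeneous_zero _ _ _, fun u x => by simp [eval_eq_jetEval]⟩

lemma IsDiffPoly.add {s : ℕ} {g h : Loop U → ℝ → ℝ} (hg : IsDiffPoly s g) (hh : IsDiffPoly s h) :
    IsDiffPoly s (fun u x => g u x + h u x) := by
  obtain ⟨p, h1, hp⟩ := hg
  obtain ⟨q, h2, hq⟩ := hh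
  exact ⟨p + q, MvPolynomial.IsWeightedHomogeneous.add h1 h2, fun u x => by simp [hp, hq, eval_eq_jetEval]⟩

lemma IsDiffPoly.mul {s t : ℕ} {g h : Loop U → ℝ → ℝ} (hg : IsDiffPoly s g) (hh : IsDiffPoly t h) :
    IsDiffPoly (s + t) (fun u x => g u x * h u x) := by
  obtain ⟨p, h1, hp⟩ := hg
  obtain ⟨q, h2, hq⟩ := hh
  exact ⟨p * q, MvPolynomial.IsWeightedHomogeneous.mul h1 h2,
    fun u x => by simp [hp, hq, eval_eq_jetEval]⟩

lemma IsDiffPoly.sum {s : ℕ} {A : Type*} (t : Finset A) {g : A → Loop U → ℝ → ℝ}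
    (hg : ∀ a ∈ t, IsDiffPoly s (g a)) : IsDiffPoly s (fun u x => ∑ a ∈ t, g a u x) := by
  classical
  induction t using Finset.induction_on with
  | empty => simpa using IsDiffPoly.zero s
  | insert a t ha ih =>
    simp only [Finset.sum_insert ha]
    exact (hg a (by simp)).add (ih fun b hb => hg b (by simp [hb]))

lemma IsDiffPoly.coeff (a : smoothFunctions U) : IsDiffPoly (U := U) 0 (fun u x => a.1 (u.1 x)) :=
  ⟨MvPolynomial.C a, MvPolynomial.isWeightedHomogeneous_C _ _,
    fun u x => by simp [eval_eq_jetEval, jet_zero]⟩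

lemma const_mem_smoothFunctions (c : ℝ) : (fun _ => c) ∈ smoothFunctions U := contDiffOn_const

lemma IsDiffPoly.const_mul (c : ℝ) {s : ℕ} {g : Loop U → ℝ → ℝ} (hg : IsDiffPoly s g) :
    IsDiffPoly s (fun u x => c * g u x) := by
  simpa using (IsDiffPoly.coeff ⟨_, const_mem_smoothFunctions c⟩).mul hg

lemma IsDiffPoly.jet (j : ℕ) (i : I) : IsDiffPoly (U := U) (j + 1) (fun u x => jet u.1 x (j + 1) i) :=
  ⟨MvPolynomial.X (j, i), MvPolynomial.isWeightedHomogeneous_X _ _ _,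
    fun u x => by simp [eval_eq_jetEval]⟩

/-- Homogeneous differential polynomials are generated by functions of the coordinates and
derivatives of coordinates. -/
lemma IsDiffPoly.induction {motive : ℕ → (Loop U → ℝ → ℝ) → Prop}
    (zero : ∀ s, motive s fun _ _ => 0)
    (coeff : ∀ a : smoothFunctions U, motive 0 fun u x => a.1 (u.1 x))
    (jet : ∀ j i, motive (j + 1) fun u x => LocalPoisson.jet u.1 x (j + 1) i)
    (add : ∀ s g h, motive s g → motive s h → motive s fun u x => g u x + h u x)
    (mul : ∀ s t g h, motive s g → motive t h → motive (s + t) fun u x => g u x * h u x)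
    {s : ℕ} {g : Loop U → ℝ → ℝ} (hg : IsDiffPoly s g) : motive s g := by
  classical
  have hone : motive 0 fun _ _ => 1 := coeff 1
  have hmon : ∀ d : ℕ × I →₀ ℕ, motive (Finsupp.weight (fun v : ℕ × I => v.1 + 1) d)
      fun u x => DiffPoly.eval (MvPolynomial.monomial d 1 : DiffPoly U) u x := by
    intro d
    induction d using Finsupp.induction_linear with
    | zero => simpa [eval_eq_jetEval] using hone
    | add d e hd he =>
      rw [map_add]
      convert mul _ _ _ _ hd he using 3
      simp only [eval_eq_jetEval, ← map_mul, MvPolynomial.monomial_mul, one_mul]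
    | single v k =>
      induction k with
      | zero => simpa [eval_eq_jetEval] using hone
      | succ k ih =>
        have hw : Finsupp.weight (fun v : ℕ × I => v.1 + 1) (Finsupp.single v 1) = v.1 + 1 := by
          simp [Finsupp.weight_single]
        rw [Finsupp.single_add, map_add, hw]
        convert mul _ _ _ _ ih (jet v.1 v.2) using 3 with u x
        rw [eval_eq_jetEval, eval_eq_jetEval, ← jetEval_X (U := U) (LocalPoisson.jet u.1 x) v, ← map_mul, MvPolynomial.X,
          MvPolynomial.monomial_mul, one_mul]
  have hterm : ∀ (d : ℕ × I →₀ ℕ) (a : smoothFunctions U),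
      motive (Finsupp.weight (fun v : ℕ × I => v.1 + 1) d)
        fun u x => DiffPoly.eval (MvPolynomial.monomial d a : DiffPoly U) u x := by
    intro d a
    have := mul _ _ _ _ (coeff a) (hmon d)
    rw [zero_add] at this
    convert this using 3 with u x
    rw [eval_eq_jetEval, eval_eq_jetEval, ← jet_zero u.1 x, ← jetEval_C, ← map_mul,
      MvPolynomial.C_mul_monomial, mul_one]
  obtain ⟨p, hp, hgp⟩ := hg
  have hsum : ∀ t : Finset (ℕ × I →₀ ℕ), t ⊆ p.support → motive s fun u x =>
      ∑ d ∈ t, DiffPoly.eval (MvPolynomial.monomial d (MvPolynomial.coeff d p) : DiffPoly U) u x := by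
    intro t
    induction t using Finset.induction_on with
    | empty => intro _; simpa using zero s
    | insert d t hd ih =>
      intro ht
      simp only [Finset.sum_insert hd]
      refine add _ _ _ ?_ (ih fun e he => ht (Finset.mem_insert_of_mem he))
      rw [← hp (MvPolynomial.mem_support_iff.1 (ht (Finset.mem_insert_self d t)))]
      exact hterm d _
  convert hsum p.support subset_rfl using 3 with u x
  rw [hgp u x]
  conv_lhs => rw [p.as_sum, eval_eq_jetEval, map_sum]
  simp only [eval_eq_jetEval]

/-- The total derivative raises the degree by one. -/
lemma IsDiffPoly.deriv (hU : IsOpen U) {s : ℕ} {g : Loop U → ℝ → ℝ} (hg : IsDiffPoly s g) :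
    IsDiffPoly (s + 1) (fun u => deriv (g u)) := by
  -- The motive carries homogeneity of `g` along with that of its derivative, because the product
  -- rule needs both for each factor.
  refine (IsDiffPoly.induction
    (motive := fun s g => IsDiffPoly s g ∧ IsDiffPoly (s + 1) (fun u => _root_.deriv (g u)))
    (fun s => ⟨IsDiffPoly.zero s, ?_⟩) (fun a => ⟨IsDiffPoly.coeff a, ?_⟩)
    (fun j i => ⟨IsDiffPoly.jet j i, ?_⟩) (fun s g h hg hh => ⟨hg.1.add hh.1, ?_⟩)
    (fun s t g h hg hh => ⟨hg.1.mul hh.1, ?_⟩) hg).2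
  · convert IsDiffPoly.zero (U := U) _ using 3
    simp
  · obtain ⟨b, hb⟩ := exists_coeff_deriv hU a
    have : IsDiffPoly (U := U) (0 + 1)
        (fun u x => ∑ i, (b i).1 (u.1 x) * LocalPoisson.jet u.1 x (0 + 1) i) :=
      IsDiffPoly.sum _ fun i _ => by simpa using (IsDiffPoly.coeff (b i)).mul (IsDiffPoly.jet 0 i)
    convert this using 1
    funext u x
    refine (hb u.1 (fun i => LocalPoisson.jet u.1 x (0 + 1) i) x (u.2.2 x)
      (hasDerivAt_pi.2 fun i => ?_)).deriv
    simpa [LocalPoisson.jet] using hasDerivAt_jet u.2.1 0 i x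
  · convert IsDiffPoly.jet (U := U) (j + 1) i using 1
    funext u x
    exact (hasDerivAt_jet u.2.1 _ _ x).deriv
  · convert hg.2.add hh.2 using 1
    funext u x
    exact deriv_fun_add (((hg.1.contDiff u).differentiable (by simp)) x)
      (((hh.1.contDiff u).differentiable (by simp)) x)
  · have h1 := hg.2.mul hh.1
    have h2 := hg.1.mul hh.2
    rw [show s + 1 + t = s + t + 1 by ring] at h1
    rw [← add_assoc] at h2
    convert h1.add h2 using 1
    funext u x
    exact deriv_fun_mul (((hg.1.contDiff u).differentiable (by simp)) x)
      (((hh.1.contDiff u).differentiable (by simp)) x)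

end Jets

/-! ### Variational derivatives -/

section Variation

variable {I : Type} [Fintype I] {U : Set (I → ℝ)}

lemma SmoothPeriodic.add_smul {u v : ℝ → I → ℝ} (hu : SmoothPeriodic u) (hv : SmoothPeriodic v)
    (t : ℝ) : SmoothPeriodic (u + t • v) := by
  refine ⟨hu.1.add (hv.1.const_smul t), fun x => ?_⟩
  simp only [Pi.add_apply, Pi.smul_apply, hu.2 x, hv.2 x]

/-- Compactness of one period makes the bound on `t` uniform in `x`. The open set is arbitrary, so
the lemma also keeps varied loops inside a neighbourhood smaller than `U`. -/
lemma eventually_add_smul_mem {V : Set (I → ℝ)} (hV : IsOpen V) {u v : ℝ → I → ℝ}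
    (hu : SmoothPeriodic u) (hv : SmoothPeriodic v) (h : ∀ x, u x ∈ V) :
    ∀ᶠ t in nhds (0 : ℝ), ∀ x, (u + t • v) x ∈ V := by
  have hcont : Continuous fun z : ℝ × ℝ => (u + z.1 • v) z.2 := by
    have h1 := hu.1.continuous
    have h2 := hv.1.continuous
    simp only [Pi.add_apply, Pi.smul_apply]
    fun_prop
  have := (isCompact_Icc (a := (0 : ℝ)) (b := 1)).eventually_forall_of_forall_eventually
    (x₀ := (0 : ℝ)) (P := fun t x => (u + t • v) x ∈ V) fun y _ =>
      hcont.continuousAt.eventually (hV.mem_nhds (by simpa using h y))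
  filter_upwards [this] with t ht x
  obtain ⟨y, hy, hxy⟩ := (hu.add_smul hv t).2.exists_mem_Ico₀ one_pos x
  rw [hxy]
  exact ht y ⟨hy.1, hy.2.le⟩

/-- The loop given by a smooth periodic curve in `U`. -/
def Loop.ofCurve (u : ℝ → I → ℝ) (hu : SmoothPeriodic u) (h : ∀ x, u x ∈ U) : Loop U := ⟨u, hu, h⟩

@[simp] lemma Loop.ofCurve_val (u : ℝ → I → ℝ) (hu : SmoothPeriodic u) (h : ∀ x, u x ∈ U) :
    (Loop.ofCurve u hu h).1 = u := rfl

lemma extend_apply_of_mem (Φ : Loop U → ℝ) {u : ℝ → I → ℝ} (hu : SmoothPeriodic u)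
    (h : ∀ x, u x ∈ U) : Function.extend Subtype.val Φ 0 u = Φ (Loop.ofCurve u hu h) :=
  Subtype.val_injective.extend_apply Φ 0 (Loop.ofCurve u hu h)

/-- Dominated convergence: on the compact product of the half-radius closed ball with the unit
interval, `F'` is bounded by a constant. -/
lemma hasDerivAt_integral_of_continuousOn {F F' : ℝ → ℝ → ℝ} {δ : ℝ} (hδ : 0 < δ)
    (hF : ContinuousOn (fun z : ℝ × ℝ => F z.1 z.2) (Metric.ball 0 δ ×ˢ Set.univ))
    (hF' : ContinuousOn (fun z : ℝ × ℝ => F' z.1 z.2) (Metric.ball 0 δ ×ˢ Set.univ))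
    (hd : ∀ t ∈ Metric.ball (0 : ℝ) δ, ∀ x, HasDerivAt (fun t => F t x) (F' t x) t) :
    HasDerivAt (fun t => ∫ x in (0 : ℝ)..1, F t x) (∫ x in (0 : ℝ)..1, F' 0 x) 0 := by
  have hslice : ∀ G : ℝ → ℝ → ℝ,
      ContinuousOn (fun z : ℝ × ℝ => G z.1 z.2) (Metric.ball 0 δ ×ˢ Set.univ) →
      ∀ t ∈ Metric.ball (0 : ℝ) δ, Continuous (G t) := by
    intro G hG t ht
    rw [← continuousOn_univ]
    exact hG.comp (f := fun x => (t, x)) (by fun_prop) fun x _ => ⟨ht, trivial⟩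
  have hsub : Metric.closedBall (0 : ℝ) (δ / 2) ⊆ Metric.ball 0 δ :=
    Metric.closedBall_subset_ball (by linarith)
  obtain ⟨C, hC⟩ := ((isCompact_closedBall (0 : ℝ) (δ / 2)).prod
    (isCompact_Icc (a := (0 : ℝ)) (b := 1))).exists_bound_of_continuousOn
    (hF'.mono (Set.prod_mono hsub (Set.subset_univ _)))
  refine (intervalIntegral.hasDerivAt_integral_of_dominated_loc_of_deriv_le
    (s := Metric.ball 0 (δ / 2)) (bound := fun _ => C)
    (Metric.ball_mem_nhds _ (by linarith)) ?_ ?_ ?_ ?_ ?_ ?_).2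
  · filter_upwards [Metric.ball_mem_nhds (0 : ℝ) hδ] with t ht
    exact (hslice F hF t ht).aestronglyMeasurable
  · exact (hslice F hF 0 (Metric.mem_ball_self hδ)).intervalIntegrable _ _
  · exact (hslice F' hF' 0 (Metric.mem_ball_self hδ)).aestronglyMeasurable
  · refine Filter.Eventually.of_forall fun x hx t ht => ?_
    rw [Set.uIoc_of_le zero_le_one] at hx
    exact hC (t, x) ⟨Metric.ball_subset_closedBall ht, hx.1.le, hx.2⟩
  · exact intervalIntegrable_const
  · exact Filter.Eventually.of_forall fun x _ t ht =>
      hd t (hsub (Metric.ball_subset_closedBall ht)) x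

lemma integral_mul_deriv_of_periodic {f g : ℝ → ℝ} (hf : ContDiff ℝ ∞ f) (hg : ContDiff ℝ ∞ g)
    (pf : Function.Periodic f 1) (pg : Function.Periodic g 1) :
    ∫ x in (0 : ℝ)..1, f x * deriv g x = - ∫ x in (0 : ℝ)..1, deriv f x * g x := by
  rw [intervalIntegral.integral_mul_deriv_eq_deriv_mul
    (fun x _ => ((hf.differentiable (by simp)) x).hasDerivAt)
    (fun x _ => ((hg.differentiable (by simp)) x).hasDerivAt)
    ((hf.continuous_deriv (by simp)).intervalIntegrable _ _)
    ((hg.continuous_deriv (by simp)).intervalIntegrable _ _)]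
  have h1 := pf 0
  have h2 := pg 0
  rw [zero_add] at h1 h2
  rw [h1, h2]; ring

lemma integral_mul_iteratedDeriv {f g : ℝ → ℝ} (hf : ContDiff ℝ ∞ f) (hg : ContDiff ℝ ∞ g)
    (pf : Function.Periodic f 1) (pg : Function.Periodic g 1) (j : ℕ) :
    ∫ x in (0 : ℝ)..1, f x * iteratedDeriv j g x =
      (-1) ^ j * ∫ x in (0 : ℝ)..1, iteratedDeriv j f x * g x := by
  induction j generalizing f with
  | zero => simp
  | succ j ih =>
    simp_rw [iteratedDeriv_succ (f := g)]
    rw [integral_mul_deriv_of_periodic hf (contDiff_iteratedDeriv hg j) pf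
      (periodic_iteratedDeriv pg j), ih (contDiff_infty_iff_deriv.1 hf).2 (periodic_deriv pf)]
    simp_rw [iteratedDeriv_succ' (f := f)]
    ring

/-- The first variation formula: local functionals have variational derivatives, which are given
by differential polynomials. -/
theorem exists_hasVarDeriv (hU : IsOpen U) (f : DiffPoly U) :
    ∃ g : I → DiffPoly U, ∀ Φ : Loop U → ℝ, (∀ u, Φ u = ∫ x in (0 : ℝ)..1, f.eval u x) →
      ∀ u, HasVarDeriv Φ u (fun x i => (g i).eval u x) := by
  obtain ⟨N, P, hP⟩ := exists_chain_rule hU f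
  choose q hq using fun j i => exists_iteratedDeriv_eval hU (P j i) j
  -- The Euler–Lagrange expression: `P j i` is the partial derivative of `f` in the `j`-th
  -- derivative of `u i`, and `q j i` is its `j`-th total derivative. The signs come from `j`
  -- integrations by parts.
  refine ⟨fun i => ∑ j ∈ Finset.range N, (-1) ^ j * q j i, fun Φ hΦ u =>
    ⟨smoothPeriodic_eval _ u, fun v hv => ?_⟩⟩
  obtain ⟨δ, hδ, hmem⟩ := Metric.eventually_nhds_iff_ball.1
    (eventually_add_smul_mem hU u.2.1 hv u.2.2)
  set J : ℝ × ℝ → ℕ → I → ℝ := fun z => jet (u.1 + z.1 • v) z.2 with hJdef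
  have hJ : J = fun z => jet u.1 z.2 + z.1 • jet v z.2 := by
    funext z; exact jet_add_smul u.2.1 hv z.1 z.2
  have hJs : ∀ j i, ContDiffOn ℝ ∞ (fun z => J z j i) (Metric.ball 0 δ ×ˢ Set.univ) := by
    intro j i
    rw [hJ]
    have h1 := contDiff_jet u.2.1 j i
    have h2 := contDiff_jet hv j i
    simp only [Pi.add_apply, Pi.smul_apply, smul_eq_mul]
    exact ((h1.comp contDiff_snd).add (contDiff_fst.mul (h2.comp contDiff_snd))).contDiffOn
  have hJU : ∀ z ∈ Metric.ball (0 : ℝ) δ ×ˢ (Set.univ : Set ℝ), J z 0 ∈ U := by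
    intro z hz
    simp only [hJdef, jet_zero]
    exact hmem z.1 hz.1 z.2
  have hcont : ∀ p : DiffPoly U, ContinuousOn (fun z => jetEval (J z) p)
      (Metric.ball 0 δ ×ˢ Set.univ) := fun p => (jetEval_contDiffOn hJs hJU p).continuousOn
  have hmain := hasDerivAt_integral_of_continuousOn (F := fun t x => jetEval (J (t, x)) f)
    (F' := fun t x => ∑ j ∈ Finset.range N, ∑ i, jetEval (J (t, x)) (P j i) * jet v x j i) hδ
    (hcont f)
    (continuousOn_finsetSum _ fun j _ => continuousOn_finsetSum _ fun i _ =>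
      (hcont (P j i)).mul ((contDiff_jet hv j i).continuous.comp continuous_snd).continuousOn)
    (fun t ht x => hP N le_rfl (fun t => J (t, x)) (jet v x) t (hJU (t, x) ⟨ht, trivial⟩)
      fun j i => by
        rw [hJ]
        simpa using ((hasDerivAt_id t).mul_const (jet v x j i)).const_add (jet u.1 x j i))
  have heq : (fun t : ℝ => Function.extend Subtype.val Φ 0 (u.1 + t • v)) =ᶠ[nhds 0]
      fun t => ∫ x in (0 : ℝ)..1, jetEval (J (t, x)) f := by
    filter_upwards [Metric.ball_mem_nhds (0 : ℝ) hδ] with t ht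
    rw [extend_apply_of_mem Φ (u.2.1.add_smul hv t) (hmem t ht), hΦ]
    simp only [eval_eq_jetEval, hJdef, Loop.ofCurve_val]
  refine (hmain.congr_of_eventuallyEq heq).congr_deriv ?_
  have hJ0 : ∀ x, J (0, x) = jet u.1 x := fun x => by simp [hJdef]
  simp only [hJ0, ← eval_eq_jetEval]
  have hcP : ∀ (p : DiffPoly U) j i, Continuous fun x => p.eval u x * jet v x j i :=
    fun p j i => (eval_contDiff p u).continuous.mul (contDiff_jet hv j i).continuous
  have hcv : ∀ (p : DiffPoly U) i, Continuous fun x => p.eval u x * v x i :=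
    fun p i => (eval_contDiff p u).continuous.mul (hv.contDiff_apply i).continuous
  rw [intervalIntegral.integral_finsetSum fun j _ =>
    (continuous_finsetSum _ fun i _ => hcP (P j i) j i).intervalIntegrable _ _,
    intervalIntegral.integral_finsetSum fun i _ => (hcv _ i).intervalIntegrable _ _]
  simp_rw [intervalIntegral.integral_finsetSum fun i _ => (hcP (P _ i) _ i).intervalIntegrable _ _]
  rw [Finset.sum_comm]
  refine Finset.sum_congr rfl fun i _ => ?_
  have : ∀ x, DiffPoly.eval (∑ j ∈ Finset.range N, (-1) ^ j * q j i) u x * v x i =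
      ∑ j ∈ Finset.range N, (-1) ^ j * ((q j i).eval u x * v x i) := by
    intro x
    simp [eval_eq_jetEval, Finset.sum_mul, mul_assoc]
  simp_rw [this]
  rw [intervalIntegral.integral_finsetSum fun j _ =>
    ((hcv (q j i) i).const_mul _).intervalIntegrable _ _]
  refine Finset.sum_congr rfl fun j _ => ?_
  rw [intervalIntegral.integral_const_mul]
  simp_rw [← hq j i u]
  exact integral_mul_iteratedDeriv (eval_contDiff (P j i) u) (hv.contDiff_apply i)
    (eval_periodic (P j i) u) (fun y => congrFun (hv.2 y) i) j

/-- The fundamental lemma of the calculus of variations on the circle. -/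
lemma eq_of_integral_eq {g h : ℝ → I → ℝ} (hg : SmoothPeriodic g) (hh : SmoothPeriodic h)
    (H : ∀ v : ℝ → I → ℝ, SmoothPeriodic v →
      ∫ x in (0 : ℝ)..1, ∑ i, g x i * v x i = ∫ x in (0 : ℝ)..1, ∑ i, h x i * v x i) : g = h := by
  -- The test direction is the difference `g - h` itself, so the hypothesis says that the integral
  -- of its square vanishes.
  have hv : SmoothPeriodic (g + (-1 : ℝ) • h) := hg.add_smul hh _
  set v := g + (-1 : ℝ) • h with hvdef
  have hvx : ∀ x i, v x i = g x i - h x i := fun x i => by simp [hvdef, sub_eq_add_neg]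
  have hi := H v hv
  have cg := fun i => (hg.contDiff_apply i).continuous
  have ch := fun i => (hh.contDiff_apply i).continuous
  have cv := fun i => (hv.contDiff_apply i).continuous
  have hint : ∫ x in (0 : ℝ)..1, ∑ i, v x i ^ 2 = 0 := by
    rw [← sub_eq_zero, ← intervalIntegral.integral_sub] at hi
    · rw [← hi]
      congr 1
      funext x
      rw [← Finset.sum_sub_distrib]
      exact Finset.sum_congr rfl fun i _ => by rw [hvx]; ring
    · exact (continuous_finsetSum _ fun i _ => (cg i).mul (cv i)).intervalIntegrable _ _
    · exact (continuous_finsetSum _ fun i _ => (ch i).mul (cv i)).intervalIntegrable _ _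
  have hcont : Continuous fun x => ∑ i, v x i ^ 2 :=
    continuous_finsetSum _ fun i _ => (cv i).pow 2
  have hzero : ∀ x ∈ Set.Icc (0 : ℝ) 1, ∑ i, v x i ^ 2 = 0 := by
    intro x hx
    by_contra hne
    have hpos := intervalIntegral.integral_pos zero_lt_one hcont.continuousOn
      (fun x _ => Finset.sum_nonneg fun i _ => sq_nonneg (v x i))
      ⟨x, hx, lt_of_le_of_ne (Finset.sum_nonneg fun i _ => sq_nonneg (v x i)) (Ne.symm hne)⟩
    exact hpos.ne' hint
  funext x i
  obtain ⟨y, hy, hxy⟩ := hv.2.exists_mem_Ico₀ one_pos x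
  have := (Finset.sum_eq_zero_iff_of_nonneg fun i _ => sq_nonneg (v y i)).1
    (hzero y ⟨hy.1, hy.2.le⟩) i (Finset.mem_univ i)
  rw [← sub_eq_zero, ← hvx, hxy]
  exact pow_eq_zero_iff two_ne_zero |>.1 this

/-- Variational derivatives are unique. -/
lemma HasVarDeriv.unique {Φ : Loop U → ℝ} {u : Loop U} {g h : ℝ → I → ℝ}
    (hg : HasVarDeriv Φ u g) (hh : HasVarDeriv Φ u h) : g = h :=
  eq_of_integral_eq hg.1 hh.1 fun v hv => (hg.2 v hv).unique (hh.2 v hv)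

lemma HasVarDeriv.varDeriv_eq {Φ : Loop U → ℝ} {u : Loop U} {g : ℝ → I → ℝ}
    (hg : HasVarDeriv Φ u g) : varDeriv Φ u = g := by
  have h : ∃ g, HasVarDeriv Φ u g := ⟨g, hg⟩
  rw [varDeriv, dif_pos h]
  exact h.choose_spec.unique hg

lemma IsLocalFunctional.exists_diffPoly (hU : IsOpen U) {Φ : Loop U → ℝ}
    (hΦ : IsLocalFunctional Φ) :
    ∃ g : I → DiffPoly U, ∀ u, HasVarDeriv Φ u (fun x i => (g i).eval u x) := by
  obtain ⟨f, hf⟩ := hΦ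
  obtain ⟨g, hg⟩ := exists_hasVarDeriv hU f
  exact ⟨g, hg Φ hf⟩

lemma IsLocalFunctional.hasVarDeriv (hU : IsOpen U) {Φ : Loop U → ℝ}
    (hΦ : IsLocalFunctional Φ) (u : Loop U) : HasVarDeriv Φ u (varDeriv Φ u) := by
  obtain ⟨g, hg⟩ := hΦ.exists_diffPoly hU
  rw [(hg u).varDeriv_eq]; exact hg u

/-- The variational derivative at `u` depends only on the functional near `u`. -/
lemma HasVarDeriv.congr_of_isOpen {Φ Ψ : Loop U → ℝ} {u : Loop U} {g : ℝ → I → ℝ}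
    {V : Set (I → ℝ)} (hU : IsOpen U) (hV : IsOpen V) (hu : ∀ x, u.1 x ∈ V)
    (h : ∀ u' : Loop U, (∀ x, u'.1 x ∈ V) → Ψ u' = Φ u') (hg : HasVarDeriv Φ u g) :
    HasVarDeriv Ψ u g := by
  refine ⟨hg.1, fun v hv => (hg.2 v hv).congr_of_eventuallyEq ?_⟩
  filter_upwards [eventually_add_smul_mem hU u.2.1 hv u.2.2,
    eventually_add_smul_mem hV u.2.1 hv hu] with t h1 h2
  rw [extend_apply_of_mem _ (u.2.1.add_smul hv t) h1, extend_apply_of_mem _ (u.2.1.add_smul hv t) h1]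
  exact h _ h2

lemma HasVarDeriv.smul_add {Φ Ψ : Loop U → ℝ} {u : Loop U} {g h : ℝ → I → ℝ} (hU : IsOpen U)
    (c : ℝ) (hg : HasVarDeriv Φ u g) (hh : HasVarDeriv Ψ u h) :
    HasVarDeriv (c • Φ + Ψ) u (h + c • g) := by
  refine ⟨hh.1.add_smul hg.1 c, fun v hv => ?_⟩
  refine ((((hg.2 v hv).const_mul c).add (hh.2 v hv)).congr_of_eventuallyEq ?_).congr_deriv ?_
  · filter_upwards [eventually_add_smul_mem hU u.2.1 hv u.2.2] with t ht
    simp only [Pi.add_apply]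
    simp only [extend_apply_of_mem _ (u.2.1.add_smul hv t) ht]
    rfl
  · have cg := fun i => (hg.1.contDiff_apply i).continuous
    have ch := fun i => (hh.1.contDiff_apply i).continuous
    have cv := fun i => (hv.contDiff_apply i).continuous
    rw [← intervalIntegral.integral_const_mul, ← intervalIntegral.integral_add]
    · congr 1
      funext x
      rw [Finset.mul_sum, ← Finset.sum_add_distrib]
      exact Finset.sum_congr rfl fun i _ => by simp; ring
    · exact ((continuous_finsetSum _ fun i _ => (cg i).mul (cv i)).const_mul c).intervalIntegrable _ _
    · exact (continuous_finsetSum _ fun i _ => (ch i).mul (cv i)).intervalIntegrable _ _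

/-- The product rule in `t`: the values `Φ u` and `Ψ u` are constants that pass under the integral.
The Leibniz rule for brackets rests on this. -/
lemma HasVarDeriv.mul {Φ Ψ : Loop U → ℝ} {u : Loop U} {g h : ℝ → I → ℝ} (hU : IsOpen U)
    (hg : HasVarDeriv Φ u g) (hh : HasVarDeriv Ψ u h) :
    HasVarDeriv (Φ * Ψ) u (Φ u • h + Ψ u • g) := by
  have hs : SmoothPeriodic (Φ u • h) := by
    have := SmoothPeriodic.add_smul (u := 0) (v := h) ⟨contDiff_const, fun _ => rfl⟩ hh.1 (Φ u)
    simpa using this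
  refine ⟨hs.add_smul hg.1 _, fun v hv => ?_⟩
  have h0 : ∀ Θ : Loop U → ℝ, Function.extend Subtype.val Θ 0 (u.1 + (0 : ℝ) • v) = Θ u := by
    intro Θ
    rw [zero_smul, add_zero]
    exact extend_apply_of_mem Θ u.2.1 u.2.2
  refine (((hg.2 v hv).mul (hh.2 v hv)).congr_of_eventuallyEq ?_).congr_deriv ?_
  · filter_upwards [eventually_add_smul_mem hU u.2.1 hv u.2.2] with t ht
    simp only [Pi.mul_apply]
    simp only [extend_apply_of_mem _ (u.2.1.add_smul hv t) ht]
    rfl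
  · have cg := fun i => (hg.1.contDiff_apply i).continuous
    have ch := fun i => (hh.1.contDiff_apply i).continuous
    have cv := fun i => (hv.contDiff_apply i).continuous
    rw [h0, h0, mul_comm _ (Ψ u), ← intervalIntegral.integral_const_mul,
      ← intervalIntegral.integral_const_mul, ← intervalIntegral.integral_add]
    · congr 1
      funext x
      rw [Finset.mul_sum, Finset.mul_sum, ← Finset.sum_add_distrib]
      exact Finset.sum_congr rfl fun i _ => by simp; ring
    · exact ((continuous_finsetSum _ fun i _ => (cg i).mul (cv i)).const_mul _).intervalIntegrable _ _
    · exact ((continuous_finsetSum _ fun i _ => (ch i).mul (cv i)).const_mul _).intervalIntegrable _ _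

end Variation

/-! ### The algebra of differential operators with graded coefficients -/

section Operators

variable {I : Type} [Fintype I] {U : Set (I → ℝ)}

/-- `T` is a scalar differential operator: a finite sum of terms `A (d/dx) ^ k` with homogeneous
differential polynomials `A`. -/
def IsOperator (T : Loop U → (ℝ → ℝ) → ℝ → ℝ) : Prop :=
  ∃ (M : ℕ) (A : ℕ → ℕ → DiffPoly U), (∀ p s, (A p s).IsHomogeneousOfDegree s) ∧
    ∀ N ≥ M, ∀ (u : Loop U) (φ : ℝ → ℝ), ContDiff ℝ ∞ φ → ∀ x, T u φ x =
      ∑ p ∈ Finset.range N, ∑ s ∈ Finset.range (p + 1),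
        (A p s).eval u x * iteratedDeriv (p - s) φ x

lemma IsOperator.congr {T T' : Loop U → (ℝ → ℝ) → ℝ → ℝ} (h : IsOperator T)
    (hT : ∀ u φ, ContDiff ℝ ∞ φ → ∀ x, T' u φ x = T u φ x) : IsOperator T' := by
  obtain ⟨M, A, hA, h⟩ := h
  exact ⟨M, A, hA, fun N hN u φ hφ x => by rw [hT u φ hφ, h N hN u φ hφ]⟩

lemma IsOperator.zero : IsOperator (U := U) (fun _ _ _ => 0) :=
  ⟨0, fun _ _ => 0, fun _ _ => MvPolynomial.isWeightedHomogeneous_zero _ _ _, fun N _ u φ _ x => by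
    simp [eval_eq_jetEval]⟩

lemma IsOperator.add {T T' : Loop U → (ℝ → ℝ) → ℝ → ℝ} (h : IsOperator T) (h' : IsOperator T') :
    IsOperator (fun u φ x => T u φ x + T' u φ x) := by
  obtain ⟨M, A, hA, h⟩ := h
  obtain ⟨M', A', hA', h'⟩ := h'
  refine ⟨max M M', fun p s => A p s + A' p s,
    fun p s => MvPolynomial.IsWeightedHomogeneous.add (hA p s) (hA' p s), fun N hN u φ hφ x => ?_⟩
  beta_reduce
  rw [h N (le_trans (le_max_left _ _) hN) u φ hφ, h' N (le_trans (le_max_right _ _) hN) u φ hφ,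
    ← Finset.sum_add_distrib]
  refine Finset.sum_congr rfl fun p _ => ?_
  rw [← Finset.sum_add_distrib]
  refine Finset.sum_congr rfl fun s _ => ?_
  simp only [eval_eq_jetEval, map_add, add_mul]

lemma IsOperator.sum {A : Type*} (t : Finset A) {T : A → Loop U → (ℝ → ℝ) → ℝ → ℝ}
    (h : ∀ a ∈ t, IsOperator (T a)) : IsOperator (fun u φ x => ∑ a ∈ t, T a u φ x) := by
  classical
  induction t using Finset.induction_on with
  | empty => simpa using IsOperator.zero
  | insert a t ha ih =>
    simp only [Finset.sum_insert ha]
    exact (h a (by simp)).add (ih fun b hb => h b (by simp [hb]))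

lemma IsOperator.monomial {s : ℕ} {g : Loop U → ℝ → ℝ} (hg : IsDiffPoly s g) (k : ℕ) :
    IsOperator (fun u φ x => g u x * iteratedDeriv k φ x) := by
  obtain ⟨q, hq, hgq⟩ := hg
  -- A coefficient of degree `s` in front of the `k`-th derivative sits at `p = s + k`, where the
  -- order `p - s` equals `k`; the range must therefore have length at least `s + k + 1`.
  refine ⟨s + k + 1, fun p t => if p = s + k then (if t = s then q else 0) else 0, ?_, ?_⟩
  · intro p t
    dsimp only
    split_ifs with h1 h2
    · rw [h2]; exact hq
    · exact MvPolynomial.isWeightedHomogeneous_zero _ _ _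
    · exact MvPolynomial.isWeightedHomogeneous_zero _ _ _
  · intro N hN u φ _ x
    rw [Finset.sum_eq_single (s + k), Finset.sum_eq_single s]
    · simp [hgq u x]
    · intro t _ ht; simp [ht, eval_eq_jetEval]
    · intro h; simp at h
    · intro p _ hp; simp [hp, eval_eq_jetEval]
    · intro h; simp at h; omega

/-- Every operator is a finite sum of monomial operators. -/
lemma IsOperator.exists_sum {T : Loop U → (ℝ → ℝ) → ℝ → ℝ} (h : IsOperator T) :
    ∃ (t : Finset (ℕ × ℕ)) (g : ℕ × ℕ → Loop U → ℝ → ℝ) (k : ℕ × ℕ → ℕ),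
      (∀ a, IsDiffPoly a.2 (g a)) ∧ ∀ u φ, ContDiff ℝ ∞ φ →
        T u φ = fun x => ∑ a ∈ t, g a u x * iteratedDeriv (k a) φ x := by
  obtain ⟨M, A, hA, h⟩ := h
  refine ⟨(Finset.range M).biUnion fun p => (Finset.range (p + 1)).image fun s => (p, s),
    fun a u x => (A a.1 a.2).eval u x, fun a => a.1 - a.2, fun a => ⟨_, hA _ _, fun _ _ => rfl⟩, ?_⟩
  intro u φ hφ
  funext x
  rw [h M le_rfl u φ hφ x, Finset.sum_biUnion]
  · refine Finset.sum_congr rfl fun p _ => ?_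
    rw [Finset.sum_image]
    intro s _ t _ hst
    exact (Prod.mk.inj hst).2
  · intro p _ q _ hpq
    simp only [Function.onFun, Finset.disjoint_left, Finset.mem_image]
    rintro _ ⟨s, _, rfl⟩ ⟨t, _, ht⟩
    exact hpq (Prod.mk.inj ht).1.symm

lemma IsOperator.contDiff {T : Loop U → (ℝ → ℝ) → ℝ → ℝ} (h : IsOperator T) (u : Loop U)
    {φ : ℝ → ℝ} (hφ : ContDiff ℝ ∞ φ) : ContDiff ℝ ∞ (T u φ) := by
  obtain ⟨t, g, k, hg, hT⟩ := h.exists_sum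
  rw [hT u φ hφ]
  exact ContDiff.sum fun a _ => ((hg a).contDiff u).mul (contDiff_iteratedDeriv hφ _)

lemma IsOperator.diffPoly_mul {T : Loop U → (ℝ → ℝ) → ℝ → ℝ} (h : IsOperator T) {s : ℕ}
    {g : Loop U → ℝ → ℝ} (hg : IsDiffPoly s g) : IsOperator (fun u φ x => g u x * T u φ x) := by
  obtain ⟨t, g', k, hg', hT⟩ := h.exists_sum
  refine (IsOperator.sum t fun a _ => IsOperator.monomial (hg.mul (hg' a)) (k a)).congr
    fun u φ hφ x => ?_
  rw [hT u φ hφ, Finset.mul_sum]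
  exact Finset.sum_congr rfl fun a _ => by ring

lemma IsOperator.const_mul (c : ℝ) {T : Loop U → (ℝ → ℝ) → ℝ → ℝ} (h : IsOperator T) :
    IsOperator (fun u φ x => c * T u φ x) :=
  h.diffPoly_mul (IsDiffPoly.coeff ⟨_, const_mem_smoothFunctions c⟩)

/-- By the product rule a term of degree `s` and order `k` yields one of degree `s + 1` and order
`k` and one of degree `s` and order `k + 1`, so the graded form survives. Closure under composition
follows from this. -/
lemma IsOperator.deriv (hU : IsOpen U) {T : Loop U → (ℝ → ℝ) → ℝ → ℝ} (h : IsOperator T) :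
    IsOperator (fun u φ => deriv (T u φ)) := by
  obtain ⟨t, g, k, hg, hT⟩ := h.exists_sum
  refine ((IsOperator.sum t fun a _ => IsOperator.monomial ((hg a).deriv hU) (k a)).add
    (IsOperator.sum t fun a _ => IsOperator.monomial (hg a) (k a + 1))).congr fun u φ hφ x => ?_
  have hd : ∀ a, HasDerivAt (fun x => g a u x * iteratedDeriv (k a) φ x)
      (_root_.deriv (g a u) x * iteratedDeriv (k a) φ x +
        g a u x * iteratedDeriv (k a + 1) φ x) x := fun a =>
    ((((hg a).contDiff u).differentiable (by simp)) x).hasDerivAt.mul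
      (hasDerivAt_iteratedDeriv hφ (k a) x)
  rw [hT u φ hφ, (HasDerivAt.fun_sum fun a _ => hd a).deriv, Finset.sum_add_distrib]

lemma IsOperator.iteratedDeriv (hU : IsOpen U) {T : Loop U → (ℝ → ℝ) → ℝ → ℝ} (h : IsOperator T)
    (k : ℕ) : IsOperator (fun u φ => iteratedDeriv k (T u φ)) := by
  induction k with
  | zero => simpa using h
  | succ k ih => simpa only [iteratedDeriv_succ] using ih.deriv hU

lemma IsOperator.comp (hU : IsOpen U) {T T' : Loop U → (ℝ → ℝ) → ℝ → ℝ} (h : IsOperator T)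
    (h' : IsOperator T') : IsOperator (fun u φ => T u (T' u φ)) := by
  obtain ⟨t, g, k, hg, hT⟩ := h.exists_sum
  refine (IsOperator.sum t fun a _ => (h'.iteratedDeriv hU (k a)).diffPoly_mul (hg a)).congr
    fun u φ hφ x => ?_
  rw [hT u _ (h'.contDiff u hφ)]

lemma IsOperator.map_add {T : Loop U → (ℝ → ℝ) → ℝ → ℝ} (h : IsOperator T) (u : Loop U)
    {φ ψ : ℝ → ℝ} (hφ : ContDiff ℝ ∞ φ) (hψ : ContDiff ℝ ∞ ψ) (x : ℝ) :
    T u (fun y => φ y + ψ y) x = T u φ x + T u ψ x := by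
  obtain ⟨t, g, k, hg, hT⟩ := h.exists_sum
  rw [hT u φ hφ, hT u ψ hψ, hT u _ (hφ.add hψ), ← Finset.sum_add_distrib]
  refine Finset.sum_congr rfl fun a _ => ?_
  rw [← mul_add]
  congr 1
  exact iteratedDeriv_add (hφ.of_le (by exact_mod_cast le_top)).contDiffAt
    (hψ.of_le (by exact_mod_cast le_top)).contDiffAt

lemma IsOperator.map_const_mul {T : Loop U → (ℝ → ℝ) → ℝ → ℝ} (h : IsOperator T) (u : Loop U)
    {φ : ℝ → ℝ} (hφ : ContDiff ℝ ∞ φ) (c x : ℝ) :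
    T u (fun y => c * φ y) x = c * T u φ x := by
  obtain ⟨t, g, k, hg, hT⟩ := h.exists_sum
  rw [hT u φ hφ, hT u _ (contDiff_const.mul hφ), Finset.mul_sum]
  refine Finset.sum_congr rfl fun a _ => ?_
  have := iteratedDeriv_fun_const_smul_field (n := k a) (x := x) c φ
  simp only [smul_eq_mul] at this
  rw [this]; ring

lemma IsOperator.map_zero {T : Loop U → (ℝ → ℝ) → ℝ → ℝ} (h : IsOperator T) (u : Loop U) (x : ℝ) :
    T u (fun _ => 0) x = 0 := by
  simpa using h.map_const_mul u (φ := fun _ => 0) contDiff_const 0 x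

lemma IsOperator.map_sum {A : Type*} (t : Finset A) {T : Loop U → (ℝ → ℝ) → ℝ → ℝ}
    (h : IsOperator T) (u : Loop U) {φ : A → ℝ → ℝ} (hφ : ∀ a, ContDiff ℝ ∞ (φ a)) (x : ℝ) :
    T u (fun y => ∑ a ∈ t, φ a y) x = ∑ a ∈ t, T u (φ a) x := by
  classical
  induction t using Finset.induction_on with
  | empty => simpa using h.map_zero u x
  | insert a t ha ih =>
    simp only [Finset.sum_insert ha]
    rw [h.map_add u (hφ a) (ContDiff.sum fun b _ => hφ b), ih]

/-! ### Matrix operators -/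

variable {A B C : Type} [Fintype B] [Fintype C]

/-- `T` is a matrix of scalar differential operators. -/
def IsMatrixOperator (T : Loop U → (ℝ → C → ℝ) → ℝ → A → ℝ) : Prop :=
  ∃ E : A → C → Loop U → (ℝ → ℝ) → ℝ → ℝ, (∀ a c, IsOperator (E a c)) ∧
    ∀ u φ, ContDiff ℝ ∞ φ → ∀ x a, T u φ x a = ∑ c, E a c u (fun y => φ y c) x

lemma IsMatrixOperator.sub {T T' : Loop U → (ℝ → C → ℝ) → ℝ → A → ℝ} (h : IsMatrixOperator T)
    (h' : IsMatrixOperator T') : IsMatrixOperator (fun u φ => T u φ - T' u φ) := by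
  obtain ⟨E, hE, hT⟩ := h
  obtain ⟨E', hE', hT'⟩ := h'
  refine ⟨fun a c u φ x => E a c u φ x + (-1) * E' a c u φ x,
    fun a c => (hE a c).add ((hE' a c).const_mul _), fun u φ hφ x a => ?_⟩
  simp only [Pi.sub_apply, hT u φ hφ, hT' u φ hφ, Finset.sum_add_distrib, ← Finset.mul_sum]
  ring

lemma IsMatrixOperator.contDiff [Fintype A] {T : Loop U → (ℝ → C → ℝ) → ℝ → A → ℝ} (h : IsMatrixOperator T)
    (u : Loop U) {φ : ℝ → C → ℝ} (hφ : ContDiff ℝ ∞ φ) : ContDiff ℝ ∞ (T u φ) := by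
  obtain ⟨E, hE, hT⟩ := h
  refine contDiff_pi.2 fun a => ?_
  simp only [hT u φ hφ]
  exact ContDiff.sum fun c _ => (hE a c).contDiff u (contDiff_pi.1 hφ c)

lemma IsMatrixOperator.map_add_smul {T : Loop U → (ℝ → C → ℝ) → ℝ → A → ℝ}
    (h : IsMatrixOperator T) (u : Loop U) {φ ψ : ℝ → C → ℝ} (hφ : ContDiff ℝ ∞ φ)
    (hψ : ContDiff ℝ ∞ ψ) (r : ℝ) : T u (φ + r • ψ) = T u φ + r • T u ψ := by
  obtain ⟨E, hE, hT⟩ := h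
  funext x a
  rw [hT u (φ + r • ψ) (hφ.add (hψ.const_smul r))]
  simp only [Pi.add_apply, Pi.smul_apply, smul_eq_mul, hT u φ hφ, hT u ψ hψ,
    Finset.mul_sum, ← Finset.sum_add_distrib]
  refine Finset.sum_congr rfl fun c _ => ?_
  rw [← (hE a c).map_const_mul u (contDiff_pi.1 hψ c),
    ← (hE a c).map_add u (contDiff_pi.1 hφ c) (contDiff_const.mul (contDiff_pi.1 hψ c))]

lemma IsMatrixOperator.comp (hU : IsOpen U) {T : Loop U → (ℝ → B → ℝ) → ℝ → A → ℝ}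
    {T' : Loop U → (ℝ → C → ℝ) → ℝ → B → ℝ} (h : IsMatrixOperator T) (h' : IsMatrixOperator T') :
    IsMatrixOperator (fun u φ => T u (T' u φ)) := by
  have hc := h'.contDiff
  obtain ⟨E, hE, hT⟩ := h
  obtain ⟨E', hE', hT'⟩ := h'
  refine ⟨fun a c u φ x => ∑ b, E a b u (E' b c u φ) x,
    fun a c => IsOperator.sum _ fun b _ => (hE a b).comp hU (hE' b c), fun u φ hφ x a => ?_⟩
  beta_reduce
  rw [hT u _ (hc u hφ), Finset.sum_comm]
  refine Finset.sum_congr rfl fun b _ => ?_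
  simp only [hT' u φ hφ]
  exact (hE a b).map_sum _ u (fun c => (hE' b c).contDiff u (contDiff_pi.1 hφ c)) x

lemma isMatrixOperator_apply (F : LocalOperator A C U) (ε : ℝ) :
    IsMatrixOperator (F.apply ε) :=
  ⟨fun a c u φ x => ∑ p ∈ Finset.range (F.top + 1), ε ^ ((p : ℤ) - 1) *
    ∑ s ∈ Finset.range (p + 1), (F.A p s a c).eval u x * iteratedDeriv (p - s) φ x,
    fun a c => IsOperator.sum _ fun p _ => (IsOperator.sum _ fun s _ =>
      IsOperator.monomial ⟨_, F.homogeneous p s a c, fun _ _ => rfl⟩ _).const_mul _,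
    fun _ _ _ _ _ => rfl⟩

lemma smoothPeriodic_apply [Fintype A] (F : LocalOperator A C U) (ε : ℝ) (u : Loop U) {φ : ℝ → C → ℝ}
    (hφ : SmoothPeriodic φ) : SmoothPeriodic (F.apply ε u φ) := by
  refine ⟨(isMatrixOperator_apply F ε).contDiff u hφ.1, fun x => ?_⟩
  funext a
  refine Finset.sum_congr rfl fun c _ => Finset.sum_congr rfl fun p _ => ?_
  congr 1
  refine Finset.sum_congr rfl fun s _ => ?_
  rw [show (F.A p s a c).eval u (x + 1) = _ from eval_periodic (F.A p s a c) u x,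
    periodic_iteratedDeriv (f := fun y => φ y c) (fun y => congrFun (hφ.2 y) c) (p - s) x]

/-- A matrix of scalar differential operators is given by a matrix differential operator. -/
lemma IsMatrixOperator.exists_localOperator [Fintype A] {T : Loop U → (ℝ → C → ℝ) → ℝ → A → ℝ}
    (h : IsMatrixOperator T) {ε : ℝ} (hε : ε ≠ 0) :
    ∃ G : LocalOperator A C U, ∀ u φ, ContDiff ℝ ∞ φ → G.apply ε u φ = T u φ := by
  obtain ⟨E, hE, hT⟩ := h
  choose M D hD h using hE
  -- The sum of all the bounds `M a c` serves as a common upper bound for the entries. The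
  -- coefficients are divided by `ε ^ (p - 1)`, which `LocalOperator.apply` multiplies back in; a
  -- constant has degree `0`, so homogeneity is unaffected.
  refine ⟨⟨∑ a, ∑ c, M a c, fun p s a c =>
    MvPolynomial.C ⟨_, const_mem_smoothFunctions (ε ^ ((p : ℤ) - 1))⁻¹⟩ * D a c p s,
    fun p s a c => ?_⟩, fun u φ hφ => ?_⟩
  · have := MvPolynomial.IsWeightedHomogeneous.mul (MvPolynomial.isWeightedHomogeneous_C
      (fun v : ℕ × I => v.1 + 1) (⟨_, const_mem_smoothFunctions (U := U) (ε ^ ((p : ℤ) - 1))⁻¹⟩ :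
        smoothFunctions U)) (hD a c p s)
    rwa [zero_add] at this
  · funext x a
    rw [hT u φ hφ]
    refine Finset.sum_congr rfl fun c _ => ?_
    have hM : M a c ≤ ∑ a, ∑ c, M a c :=
      (Finset.single_le_sum (f := fun c => M a c) (fun _ _ => Nat.zero_le _)
        (Finset.mem_univ c)).trans (Finset.single_le_sum (f := fun a => ∑ c, M a c)
        (fun _ _ => Nat.zero_le _) (Finset.mem_univ a))
    rw [h a c _ (hM.trans (Nat.le_succ _)) u _ (contDiff_pi.1 hφ c)]
    refine Finset.sum_congr rfl fun p _ => ?_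
    rw [Finset.mul_sum]
    refine Finset.sum_congr rfl fun s _ => ?_
    simp only [eval_eq_jetEval, map_mul, jetEval_C]
    rw [← mul_assoc, ← mul_assoc, mul_inv_cancel₀ (zpow_ne_zero _ hε), one_mul]

/-- A differential operator maps differential polynomials to differential polynomials. -/
lemma exists_apply_eval (hU : IsOpen U) (F : LocalOperator A C U) (ε : ℝ) (g : C → DiffPoly U) :
    ∃ h : A → DiffPoly U, ∀ u x a,
      F.apply ε u (fun x c => (g c).eval u x) x a = (h a).eval u x := by
  choose q hq using fun c j => exists_iteratedDeriv_eval hU (g c) j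
  refine ⟨fun a => ∑ c, ∑ p ∈ Finset.range (F.top + 1),
    MvPolynomial.C ⟨_, const_mem_smoothFunctions (ε ^ ((p : ℤ) - 1))⟩ *
      ∑ s ∈ Finset.range (p + 1), F.A p s a c * q c (p - s), fun u x a => ?_⟩
  simp only [LocalOperator.apply, hq]
  simp only [eval_eq_jetEval, _root_.map_sum, map_mul, jetEval_C]

end Operators

/-! ### Restriction to the slice and the Dirac equations -/

section Slice

variable {I K A C : Type} [Fintype I] [Fintype K] {U : Set (I ⊕ K → ℝ)}

omit [Fintype I] [Fintype K] in
lemma continuous_sumElim_zero : Continuous fun y : I → ℝ => (Sum.elim y 0 : I ⊕ K → ℝ) := by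
  refine continuous_pi ?_
  rintro (i | k)
  · exact continuous_apply i
  · exact continuous_const

omit [Fintype I] [Fintype K] in
lemma isOpen_slice (hU : IsOpen U) : IsOpen (slice U) := hU.preimage continuous_sumElim_zero

lemma inclusion_val (w : Loop (slice U)) : (inclusion w).1 = fun x => Sum.elim (w.1 x) 0 := rfl

lemma jet_inclusion_inl (w : Loop (slice U)) (x : ℝ) (j : ℕ) (i : I) :
    jet (inclusion w).1 x j (Sum.inl i) = jet w.1 x j i := rfl

lemma jet_inclusion_inr (w : Loop (slice U)) (x : ℝ) (j : ℕ) (k : K) :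
    jet (inclusion w).1 x j (Sum.inr k) = 0 := by
  simp [jet, inclusion_val]

/-- Along loops in the slice the normal coordinates and all their derivatives vanish, so the
generators restrict to generators of the same degree or to zero. -/
lemma IsDiffPoly.restrict {s : ℕ} {g : Loop U → ℝ → ℝ} (hg : IsDiffPoly s g) :
    IsDiffPoly s (fun w : Loop (slice U) => g (inclusion w)) := by
  refine IsDiffPoly.induction (motive := fun s g =>
    IsDiffPoly s (fun w : Loop (slice U) => g (inclusion w))) IsDiffPoly.zero (fun a => ?_) ?_
    (fun s g h hg hh => hg.add hh) (fun s t g h hg hh => hg.mul hh) hg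
  · have ha : (fun y : I → ℝ => a.1 (Sum.elim y 0)) ∈ smoothFunctions (slice U) := by
      refine ContDiffOn.comp (t := U) a.2 ?_ fun y hy => hy
      refine contDiffOn_pi.2 ?_
      rintro (i | k)
      · exact (contDiff_apply ℝ ℝ i).contDiffOn
      · exact contDiffOn_const
    exact IsDiffPoly.coeff ⟨_, ha⟩
  · rintro j (i | k)
    · exact IsDiffPoly.jet j i
    · simp only [jet_inclusion_inr]
      exact IsDiffPoly.zero _

lemma IsOperator.restrict {T : Loop U → (ℝ → ℝ) → ℝ → ℝ} (h : IsOperator T) :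
    IsOperator (fun w : Loop (slice U) => T (inclusion w)) := by
  obtain ⟨t, g, k, hg, hT⟩ := h.exists_sum
  exact (IsOperator.sum t fun a _ => IsOperator.monomial (hg a).restrict (k a)).congr
    fun w φ hφ x => congrFun (hT _ φ hφ) x

lemma IsMatrixOperator.restrict [Fintype C] {T : Loop U → (ℝ → C → ℝ) → ℝ → A → ℝ}
    (h : IsMatrixOperator T) : IsMatrixOperator (fun w : Loop (slice U) => T (inclusion w)) := by
  obtain ⟨E, hE, hT⟩ := h
  exact ⟨_, fun a c => (hE a c).restrict, fun w => hT (inclusion w)⟩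

lemma SmoothPeriodic.sumElim {φ : ℝ → I → ℝ} {ψ : ℝ → K → ℝ} (hφ : SmoothPeriodic φ)
    (hψ : SmoothPeriodic ψ) : SmoothPeriodic (fun x => Sum.elim (φ x) (ψ x)) := by
  rw [smoothPeriodic_iff] at hφ hψ ⊢
  rintro (i | k)
  · exact hφ i
  · exact hψ k

lemma smoothPeriodic_zero : SmoothPeriodic (0 : ℝ → I → ℝ) := ⟨contDiff_const, fun _ => rfl⟩

lemma SmoothPeriodic.neg {φ : ℝ → I → ℝ} (hφ : SmoothPeriodic φ) : SmoothPeriodic (-φ) := by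
  simpa using smoothPeriodic_zero.add_smul hφ (-1)

lemma SmoothPeriodic.inl {φ : ℝ → I ⊕ K → ℝ} (h : SmoothPeriodic φ) :
    SmoothPeriodic (fun x i => φ x (Sum.inl i)) :=
  smoothPeriodic_iff.2 fun i => smoothPeriodic_iff.1 h (Sum.inl i)

lemma SmoothPeriodic.inr {φ : ℝ → I ⊕ K → ℝ} (h : SmoothPeriodic φ) :
    SmoothPeriodic (fun x k => φ x (Sum.inr k)) :=
  smoothPeriodic_iff.2 fun k => smoothPeriodic_iff.1 h (Sum.inr k)

/-- The variational derivative of a restricted functional consists of the components of the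
variational derivative that are tangent to the slice. -/
lemma HasVarDeriv.restrict (hU : IsOpen U) {Φ : Loop U → ℝ} {w : Loop (slice U)}
    {g : ℝ → I ⊕ K → ℝ} (hg : HasVarDeriv Φ (inclusion w) g) :
    HasVarDeriv (fun w' => Φ (inclusion w')) w (fun x i => g x (Sum.inl i)) := by
  refine ⟨hg.1.inl, fun v hv => ?_⟩
  have hv' : SmoothPeriodic (fun x => (Sum.elim (v x) 0 : I ⊕ K → ℝ)) :=
    hv.sumElim smoothPeriodic_zero
  refine ((hg.2 _ hv').congr_of_eventuallyEq ?_).congr_deriv ?_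
  · filter_upwards [eventually_add_smul_mem (isOpen_slice hU) w.2.1 hv w.2.2,
      eventually_add_smul_mem hU (inclusion w).2.1 hv' (inclusion w).2.2] with t h1 h2
    rw [extend_apply_of_mem _ (w.2.1.add_smul hv t) h1,
      extend_apply_of_mem _ ((inclusion w).2.1.add_smul hv' t) h2]
    congr 1
    refine Subtype.ext ?_
    funext x
    rw [inclusion_val, Loop.ofCurve_val, Loop.ofCurve_val, inclusion_val]
    funext a
    rcases a with i | k <;> simp
  · simp [Fintype.sum_sum_type]

/-- Block decomposition by columns; the row selection `f` is left free so that the tangent rows and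
the normal rows are treated together. -/
lemma apply_eq_add {R : Type} (F : LocalOperator R (I ⊕ K) U) (ε : ℝ) (u : Loop U) (f : A → R)
    (φ : ℝ → I ⊕ K → ℝ) (x : ℝ) (a : A) : F.apply ε u φ x (f a) =
      (F.submatrix f Sum.inl).apply ε u (fun x i => φ x (Sum.inl i)) x a +
      (F.submatrix f Sum.inr).apply ε u (fun x k => φ x (Sum.inr k)) x a := by
  simp only [LocalOperator.apply, LocalOperator.submatrix, Fintype.sum_sum_type]

omit [Fintype K] in
lemma IsMatrixOperator.map_neg [Fintype C] {V : Set (I → ℝ)}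
    {T : Loop V → (ℝ → C → ℝ) → ℝ → A → ℝ} (h : IsMatrixOperator T) (u : Loop V)
    {φ : ℝ → C → ℝ} (hφ : ContDiff ℝ ∞ φ) : T u (-φ) = - T u φ := by
  -- The operator is evaluated on the zero function, written both as `φ - φ` and as `-φ + φ`.
  have h1 := h.map_add_smul u hφ hφ (-1)
  have h2 := h.map_add_smul u (show ContDiff ℝ ∞ (-φ) from hφ.neg) hφ 1
  rw [show -φ + (1 : ℝ) • φ = φ + (-1 : ℝ) • φ by rw [one_smul, neg_smul, one_smul]; abel] at h2
  rw [h1] at h2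
  simp only [one_smul, neg_smul] at h2
  rw [add_neg_cancel] at h2
  exact eq_neg_of_add_eq_zero_left h2.symm

/-- Existence of the operator `F_II - F_IK S F_KI` on the loop space of the slice. -/
lemma exists_reducedOperator (hU : IsOpen U) {ε : ℝ} (hε : ε ≠ 0)
    (F : LocalOperator (I ⊕ K) (I ⊕ K) U) (S : LocalOperator K K (slice U)) :
    ∃ G : LocalOperator I I (slice U), ∀ (w : Loop (slice U)) (ψ : ℝ → I → ℝ), SmoothPeriodic ψ →
      G.apply ε w ψ = (F.submatrix Sum.inl Sum.inl).apply ε (inclusion w) ψ -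
        (F.submatrix Sum.inl Sum.inr).apply ε (inclusion w)
          (S.apply ε w ((F.submatrix Sum.inr Sum.inl).apply ε (inclusion w) ψ)) := by
  have hs := isOpen_slice (I := I) (K := K) hU
  obtain ⟨G, hG⟩ := ((isMatrixOperator_apply (F.submatrix Sum.inl Sum.inl) ε).restrict.sub
    ((isMatrixOperator_apply (F.submatrix Sum.inl Sum.inr) ε).restrict.comp hs
      ((isMatrixOperator_apply S ε).comp hs
        (isMatrixOperator_apply (F.submatrix Sum.inr Sum.inl) ε).restrict))).exists_localOperator hε
  exact ⟨G, fun w ψ hψ => hG w ψ hψ.1⟩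

/-- The covectors `(ψ, χ)` along the slice whose Hamiltonian vector field is tangent to the
slice are those with `χ = - S F_KI ψ`. -/
lemma tangent_iff {ε : ℝ} {F : LocalOperator (I ⊕ K) (I ⊕ K) U} {S : LocalOperator K K (slice U)}
    (hS : IsInverseOfMinor ε F S) (w : Loop (slice U)) {ψ : ℝ → I → ℝ} {χ : ℝ → K → ℝ}
    (hψ : SmoothPeriodic ψ) (hχ : SmoothPeriodic χ) :
    (F.submatrix Sum.inr Sum.inl).apply ε (inclusion w) ψ +
      (F.submatrix Sum.inr Sum.inr).apply ε (inclusion w) χ = 0 ↔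
    χ = - S.apply ε w ((F.submatrix Sum.inr Sum.inl).apply ε (inclusion w) ψ) := by
  have h1 := smoothPeriodic_apply (F.submatrix Sum.inr Sum.inl) ε (inclusion w) hψ
  have h2 := smoothPeriodic_apply S ε w h1
  constructor
  -- Uniqueness of `χ` uses that `S` is a left inverse of the minor.
  · intro h
    have h3 := (hS w χ hχ).1
    rw [eq_neg_of_add_eq_zero_right h, (isMatrixOperator_apply S ε).map_neg w h1.1] at h3
    exact h3.symm
  -- Existence uses that `S` is a right inverse.
  · rintro rfl
    rw [(isMatrixOperator_apply _ ε).map_neg _ h2.1, (hS w _ h1).2, add_neg_cancel]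

/-- A multiplier `c` replaces the normal part `χ` of the variational derivative by `χ + c`. Hence
`tangent_iff` determines `χ + c`, leaving `c = - S F_KI ψ - χ` as the only solution, and the
original `χ` drops out of the tangent component. -/
lemma isDiracReduction (hU : IsOpen U) {ε : ℝ} {F : LocalOperator (I ⊕ K) (I ⊕ K) U}
    {S : LocalOperator K K (slice U)} (hS : IsInverseOfMinor ε F S)
    {G : LocalOperator I I (slice U)}
    (hG : ∀ (w : Loop (slice U)) (ψ : ℝ → I → ℝ), SmoothPeriodic ψ →
      G.apply ε w ψ = (F.submatrix Sum.inl Sum.inl).apply ε (inclusion w) ψ -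
        (F.submatrix Sum.inl Sum.inr).apply ε (inclusion w)
          (S.apply ε w ((F.submatrix Sum.inr Sum.inl).apply ε (inclusion w) ψ))) :
    IsDiracReduction ε F G := by
  intro Φ hΦ w
  have hφ := hΦ.hasVarDeriv hU (inclusion w)
  rw [(hφ.restrict hU).varDeriv_eq]
  set φ := varDeriv Φ (inclusion w) with hφdef
  set ψ : ℝ → I → ℝ := fun x i => φ x (Sum.inl i) with hψdef
  set χ : ℝ → K → ℝ := fun x k => φ x (Sum.inr k) with hχdef
  have hψ : SmoothPeriodic ψ := hφ.1.inl
  have hχ : SmoothPeriodic χ := hφ.1.inr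
  have hsum : ∀ {c : ℝ → K → ℝ}, SmoothPeriodic c → SmoothPeriodic (χ + c) := fun hc => by
    simpa using hχ.add_smul hc 1
  have hfield : ∀ {B : Type} (f : B → I ⊕ K) (c : ℝ → K → ℝ), SmoothPeriodic c → ∀ x b,
      diracField ε F Φ (inclusion w) c x (f b) =
        (F.submatrix f Sum.inl).apply ε (inclusion w) ψ x b +
        (F.submatrix f Sum.inr).apply ε (inclusion w) (χ + c) x b := by
    intro B f c hc x b
    have := (isMatrixOperator_apply (F.submatrix f Sum.inr) ε).map_add_smul (inclusion w)
      hχ.1 hc.1 1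
    rw [one_smul, one_smul] at this
    rw [this]
    simp only [diracField, Pi.add_apply, ← hφdef, apply_eq_add F ε _ f, add_assoc]
    rfl
  have htangent : ∀ c : ℝ → K → ℝ, SmoothPeriodic c →
      ((∀ x k, diracField ε F Φ (inclusion w) c x (Sum.inr k) = 0) ↔
        χ + c = - S.apply ε w ((F.submatrix Sum.inr Sum.inl).apply ε (inclusion w) ψ)) := by
    intro c hc
    rw [← tangent_iff hS w hψ (hsum hc)]
    simp only [hfield Sum.inr c hc, funext_iff]
    rfl
  have hmult := smoothPeriodic_apply S ε w
    (smoothPeriodic_apply (F.submatrix Sum.inr Sum.inl) ε (inclusion w) hψ)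
  refine ⟨⟨- S.apply ε w ((F.submatrix Sum.inr Sum.inl).apply ε (inclusion w) ψ) - χ, ⟨?_, ?_⟩, ?_⟩,
    ?_⟩
  · simpa [sub_eq_add_neg] using hmult.neg.add_smul hχ (-1)
  · refine (htangent _ ?_).2 (by abel)
    simpa [sub_eq_add_neg] using hmult.neg.add_smul hχ (-1)
  · rintro c ⟨hc, hc'⟩
    rw [← (htangent c hc).1 hc']; abel
  · intro c hc hc' x i
    rw [hfield Sum.inl c hc, (htangent c hc).1 hc', hG w ψ hψ,
      (isMatrixOperator_apply _ ε).map_neg _ hmult.1, sub_eq_add_neg]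
    rfl

end Slice

/-! ### Extending functionals off the slice -/

section Extension

variable {I K : Type} [Fintype I] [Fintype K] {U : Set (I ⊕ K → ℝ)}

/-- Near a loop in the slice, differential polynomials on the slice extend to differential
polynomials on the ambient domain. -/
lemma exists_extension (hU : IsOpen U) (w : Loop (slice U)) :
    ∃ V : Set (I ⊕ K → ℝ), IsOpen V ∧ (∀ x, (inclusion w).1 x ∈ V) ∧
      ∀ p : DiffPoly (slice U), ∃ q : DiffPoly U, ∀ J : ℕ → I ⊕ K → ℝ, J 0 ∈ V →
        jetEval J q = jetEval (fun j i => J j (Sum.inl i)) p := by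
  -- A coefficient on the slice pulls back under the projection only to `O`, which need not contain
  -- `U`. A cutoff supported in `O` and equal to `1` near the compact image of the loop repairs
  -- this.
  set O : Set (I ⊕ K → ℝ) := {y | (fun i => y (Sum.inl i)) ∈ slice U} with hOdef
  have hproj : ContDiff ℝ ∞ fun (y : I ⊕ K → ℝ) (i : I) => y (Sum.inl i) :=
    contDiff_pi.2 fun i => contDiff_apply ℝ ℝ (Sum.inl i)
  have hO : IsOpen O := (isOpen_slice hU).preimage hproj.continuous
  have hcompact : IsCompact (Set.range (inclusion w).1) :=
    (inclusion w).2.1.2.compact_of_continuous one_ne_zero (inclusion w).2.1.1.continuous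
  obtain ⟨χ, hχ0, hχ1, -⟩ := exists_contMDiffMap_zero_one_nhds_of_isClosed (n := ⊤)
    (modelWithCornersSelf ℝ (I ⊕ K → ℝ)) hO.isClosed_compl hcompact.isClosed (by
      rw [Set.disjoint_compl_left_iff_subset]
      rintro _ ⟨x, rfl⟩
      exact w.2.2 x)
  have hχ : ContDiff ℝ ∞ χ := χ.contMDiff.contDiff
  -- `V` is fixed before any polynomial is given, so several functionals can later be extended over
  -- the same neighbourhood.
  obtain ⟨V, hV, hwV, hV1⟩ := mem_nhdsSet_iff_exists.1 hχ1
  refine ⟨V, hV, fun x => hwV ⟨x, rfl⟩, fun p => ?_⟩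
  induction p using MvPolynomial.induction_on with
  | C a =>
    have ha : (fun y => χ y * a.1 fun i => y (Sum.inl i)) ∈ smoothFunctions U := by
      refine fun y _ => ContDiffAt.contDiffWithinAt ?_
      by_cases hy : y ∈ O
      · have h1 : ContDiffAt ℝ ∞ a.1 (fun i => y (Sum.inl i)) :=
          ContDiffOn.contDiffAt a.2 ((isOpen_slice hU).mem_nhds hy)
        exact hχ.contDiffAt.mul (h1.comp y hproj.contDiffAt)
      · have h0 : ∀ᶠ z in nhds y, χ z = 0 := Filter.Eventually.filter_mono (nhds_le_nhdsSet hy) hχ0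
        refine (contDiffAt_const (c := (0 : ℝ))).congr_of_eventuallyEq ?_
        filter_upwards [h0] with z hz
        rw [hz, zero_mul]
    refine ⟨MvPolynomial.C ⟨_, ha⟩, fun J hJ => ?_⟩
    rw [jetEval_C, jetEval_C]
    dsimp only
    rw [show χ (J 0) = 1 from hV1 hJ, one_mul]
  | add p q hp hq =>
    obtain ⟨p', hp⟩ := hp
    obtain ⟨q', hq⟩ := hq
    exact ⟨p' + q', fun J hJ => by rw [map_add, map_add, hp J hJ, hq J hJ]⟩
  | mul_X p v hp =>
    obtain ⟨p', hp⟩ := hp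
    exact ⟨p' * MvPolynomial.X (v.1, Sum.inl v.2), fun J hJ => by
      rw [map_mul, map_mul, hp J hJ, jetEval_X, jetEval_X]⟩

/-- A local functional on the loop space of the slice extends, near a loop, to a local functional
on the ambient loop space with prescribed transversal variational derivative. -/
lemma exists_functional_extension (hU : IsOpen U) {V : Set (I ⊕ K → ℝ)} (hV : IsOpen V)
    (hext : ∀ p : DiffPoly (slice U), ∃ q : DiffPoly U, ∀ J : ℕ → I ⊕ K → ℝ, J 0 ∈ V →
        jetEval J q = jetEval (fun j i => J j (Sum.inl i)) p)
    {Φ : Loop (slice U) → ℝ} (hΦ : IsLocalFunctional Φ) (c : K → DiffPoly (slice U)) :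
    ∃ Ψ : Loop U → ℝ, IsLocalFunctional Ψ ∧
      ∀ w : Loop (slice U), (∀ x, (inclusion w).1 x ∈ V) → Ψ (inclusion w) = Φ w ∧
        ∀ x k, varDeriv Ψ (inclusion w) x (Sum.inr k) = (c k).eval w x := by
  obtain ⟨f, hf⟩ := hΦ
  obtain ⟨f', hf'⟩ := hext f
  choose c' hc' using fun k => hext (c k)
  have hcoord : ∀ k : K, (fun y : I ⊕ K → ℝ => y (Sum.inr k)) ∈ smoothFunctions U :=
    fun k => (contDiff_apply ℝ ℝ (Sum.inr k)).contDiffOn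
  -- The added term is linear in the normal coordinates: it vanishes on the slice and contributes
  -- exactly `c k` to the `k`-th normal derivative there.
  set F : DiffPoly U := f' + ∑ k, MvPolynomial.C ⟨_, hcoord k⟩ * c' k with hFdef
  have hF : ∀ (J : ℕ → I ⊕ K → ℝ), J 0 ∈ V → jetEval J F =
      jetEval (fun j i => J j (Sum.inl i)) f +
        ∑ k, J 0 (Sum.inr k) * jetEval (fun j i => J j (Sum.inl i)) (c k) := by
    intro J hJ
    simp only [hFdef, map_add, map_sum, map_mul, jetEval_C, hf' J hJ, hc' _ J hJ]
  set Ψ : Loop U → ℝ := fun u => ∫ x in (0 : ℝ)..1, F.eval u x with hΨdef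
  have hΨ : IsLocalFunctional Ψ := ⟨F, fun _ => rfl⟩
  refine ⟨Ψ, hΨ, fun w hw => ⟨?_, ?_⟩⟩
  · simp only [hΨdef, hf w, eval_eq_jetEval]
    congr 1
    funext x
    rw [hF _ (by rw [jet_zero]; exact hw x)]
    simp only [jet_inclusion_inr, zero_mul, Finset.sum_const_zero, add_zero, jet_inclusion_inl]
  · have hg := hΨ.hasVarDeriv hU (inclusion w)
    have key : (fun x k => varDeriv Ψ (inclusion w) x (Sum.inr k)) =
        fun x k => (c k).eval w x := by
      refine eq_of_integral_eq hg.1.inr (smoothPeriodic_eval c w) fun v hv => ?_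
      have hv' : SmoothPeriodic (fun x => (Sum.elim 0 (v x) : I ⊕ K → ℝ)) :=
        smoothPeriodic_zero.sumElim hv
      have h1 := hg.2 _ hv'
      simp only [Fintype.sum_sum_type, Sum.elim_inl, Sum.elim_inr, Pi.zero_apply, mul_zero,
        Finset.sum_const_zero, zero_add] at h1
      -- A purely normal variation leaves the tangent jets unchanged, so for small `t` the
      -- functional is affine in `t` and its derivative is read off directly.
      have h2 : HasDerivAt (fun t : ℝ => Φ w + t * ∫ x in (0 : ℝ)..1, ∑ k, (c k).eval w x * v x k)
          (∫ x in (0 : ℝ)..1, ∑ k, (c k).eval w x * v x k) 0 := by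
        simpa using ((hasDerivAt_id (0 : ℝ)).mul_const
          (∫ x in (0 : ℝ)..1, ∑ k, (c k).eval w x * v x k)).const_add (Φ w)
      refine h1.unique (h2.congr_of_eventuallyEq ?_)
      filter_upwards [eventually_add_smul_mem hU (inclusion w).2.1 hv' (inclusion w).2.2,
        eventually_add_smul_mem hV (inclusion w).2.1 hv' hw] with t ht1 ht2
      rw [extend_apply_of_mem _ ((inclusion w).2.1.add_smul hv' t) ht1,
        ← intervalIntegral.integral_const_mul, hf w, ← intervalIntegral.integral_add]
      · simp only [hΨdef, eval_eq_jetEval, Loop.ofCurve_val]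
        congr 1
        funext x
        have hinl : ∀ j i, jet ((inclusion w).1 + t • fun x => (Sum.elim 0 (v x) : I ⊕ K → ℝ)) x j
            (Sum.inl i) = jet w.1 x j i := by
          intro j i
          simp [jet, inclusion_val]
        rw [hF _ (by rw [jet_zero]; exact ht2 x)]
        simp only [hinl, jet_zero, Finset.mul_sum]
        congr 1
        refine Finset.sum_congr rfl fun k _ => ?_
        simp [inclusion_val]
        ring
      · exact (eval_contDiff f w).continuous.intervalIntegrable _ _
      · exact (continuous_const.mul (continuous_finsetSum _ fun k _ =>
          (eval_contDiff (c k) w).continuous.mul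
            (hv.contDiff_apply k).continuous)).intervalIntegrable _ _
    exact fun x k => congrFun (congrFun key x) k

/-- Agreement on loops in `V` is enough, because a variational derivative depends only on the
functional near the loop. -/
lemma varDeriv_of_eq_inclusion (hU : IsOpen U) {V : Set (I ⊕ K → ℝ)} (hV : IsOpen V)
    {Φ : Loop (slice U) → ℝ} {Ψ : Loop U → ℝ} (hΨ : IsLocalFunctional Ψ)
    (h : ∀ w : Loop (slice U), (∀ x, (inclusion w).1 x ∈ V) → Ψ (inclusion w) = Φ w)
    {w : Loop (slice U)} (hw : ∀ x, (inclusion w).1 x ∈ V) :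
    varDeriv Φ w = fun x i => varDeriv Ψ (inclusion w) x (Sum.inl i) :=
  (((hΨ.hasVarDeriv hU (inclusion w)).restrict hU).congr_of_isOpen
    (V := {y | Sum.elim y 0 ∈ V}) (isOpen_slice hU) (hV.preimage continuous_sumElim_zero) hw
    fun w' hw' => (h w' hw').symm).varDeriv_eq

/-- Near a loop, local functionals on the loop space of the slice extend to local functionals
whose Hamiltonian vector fields are tangent to the loop space of the slice. -/
lemma exists_tangent_extension (hU : IsOpen U) {ε : ℝ} (hε : ε ≠ 0)
    {F : LocalOperator (I ⊕ K) (I ⊕ K) U} {S : LocalOperator K K (slice U)}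
    (hS : IsInverseOfMinor ε F S) {G : LocalOperator I I (slice U)}
    (hG : ∀ (w : Loop (slice U)) (ψ : ℝ → I → ℝ), SmoothPeriodic ψ →
      G.apply ε w ψ = (F.submatrix Sum.inl Sum.inl).apply ε (inclusion w) ψ -
        (F.submatrix Sum.inl Sum.inr).apply ε (inclusion w)
          (S.apply ε w ((F.submatrix Sum.inr Sum.inl).apply ε (inclusion w) ψ)))
    (w : Loop (slice U)) :
    ∃ V : Set (I ⊕ K → ℝ), IsOpen V ∧ (∀ x, (inclusion w).1 x ∈ V) ∧
      ∀ Φ : Loop (slice U) → ℝ, IsLocalFunctional Φ → ∃ Ψ : Loop U → ℝ, IsLocalFunctional Ψ ∧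
        ∀ w : Loop (slice U), (∀ x, (inclusion w).1 x ∈ V) → Ψ (inclusion w) = Φ w ∧
          F.apply ε (inclusion w) (varDeriv Ψ (inclusion w)) =
            fun x => Sum.elim (G.apply ε w (varDeriv Φ w) x) 0 := by
  have hs := isOpen_slice (I := I) (K := K) hU
  obtain ⟨V, hV, hwV, hext⟩ := exists_extension hU w
  refine ⟨V, hV, hwV, fun Φ hΦ => ?_⟩
  obtain ⟨g, hg⟩ := hΦ.exists_diffPoly hs
  obtain ⟨F', hF'⟩ := (isMatrixOperator_apply (F.submatrix Sum.inr Sum.inl)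
    ε).restrict.exists_localOperator hε
  obtain ⟨h, hh⟩ := exists_apply_eval hs F' ε g
  obtain ⟨h', hh'⟩ := exists_apply_eval hs S ε h
  -- Here `h'` represents `S F_KI` applied to the variational derivative of `Φ`, so the prescribed
  -- normal part `- h'` is the solution in `tangent_iff`.
  obtain ⟨Ψ, hΨ, H⟩ := exists_functional_extension hU hV hext hΦ (fun k => - h' k)
  refine ⟨Ψ, hΨ, fun w hw => ⟨(H w hw).1, ?_⟩⟩
  have hψ := (hΦ.hasVarDeriv hs w).1
  have hinl := varDeriv_of_eq_inclusion hU hV hΨ (fun w hw => (H w hw).1) hw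
  have hinr : (fun x k => varDeriv Ψ (inclusion w) x (Sum.inr k)) = - S.apply ε w
      ((F.submatrix Sum.inr Sum.inl).apply ε (inclusion w) (varDeriv Φ w)) := by
    rw [← hF' w _ hψ.1, (hg w).varDeriv_eq]
    funext x k
    rw [(H w hw).2 x k, show F'.apply ε w (fun x i => (g i).eval w x) =
      fun x k => (h k).eval w x from funext fun x => funext fun k => hh w x k]
    simp only [Pi.neg_apply, hh']
    simp only [eval_eq_jetEval, map_neg]
  have hmult := smoothPeriodic_apply S ε w
    (smoothPeriodic_apply (F.submatrix Sum.inr Sum.inl) ε (inclusion w) hψ)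
  funext x a
  rcases a with i | k
  · rw [apply_eq_add F ε _ Sum.inl, ← hinl, hinr, (isMatrixOperator_apply _ ε).map_neg _ hmult.1,
      Sum.elim_inl, hG w _ hψ, sub_eq_add_neg]
    rfl
  · rw [apply_eq_add F ε _ Sum.inr, ← hinl, hinr, (isMatrixOperator_apply _ ε).map_neg _ hmult.1,
      (hS w _ (smoothPeriodic_apply _ ε _ hψ)).2]
    simp

/-- The bracket with a functional whose Hamiltonian vector field is tangent to the slice depends
only on the restrictions to the slice. -/
lemma bracket_inclusion (hU : IsOpen U) {ε : ℝ} {F : LocalOperator (I ⊕ K) (I ⊕ K) U}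
    {G : LocalOperator I I (slice U)} {V : Set (I ⊕ K → ℝ)} (hV : IsOpen V)
    {Φ Ψ : Loop (slice U) → ℝ} {Φ' Ψ' : Loop U → ℝ} (hΦ' : IsLocalFunctional Φ')
    (h : ∀ w : Loop (slice U), (∀ x, (inclusion w).1 x ∈ V) → Φ' (inclusion w) = Φ w)
    {w : Loop (slice U)} (hw : ∀ x, (inclusion w).1 x ∈ V)
    (hΨ' : F.apply ε (inclusion w) (varDeriv Ψ' (inclusion w)) =
      fun x => Sum.elim (G.apply ε w (varDeriv Ψ w) x) 0) :
    bracket ε F Φ' Ψ' (inclusion w) = bracket ε G Φ Ψ w := by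
  simp only [bracket, hΨ', varDeriv_of_eq_inclusion hU hV hΦ' h hw, Fintype.sum_sum_type,
    Sum.elim_inl, Sum.elim_inr, Pi.zero_apply, mul_zero, Finset.sum_const_zero, add_zero]

end Extension

/-! ### Bracket properties valid for every matrix differential operator -/

section Brackets

variable {I : Type} [Fintype I] {U : Set (I → ℝ)}

lemma isLocalFunctional_bracket (hU : IsOpen U) (ε : ℝ) (G : LocalOperator I I U)
    {Φ Ψ : Loop U → ℝ} (hΦ : IsLocalFunctional Φ) (hΨ : IsLocalFunctional Ψ) :
    IsLocalFunctional (bracket ε G Φ Ψ) := by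
  obtain ⟨g, hg⟩ := hΦ.exists_diffPoly hU
  obtain ⟨h, hh⟩ := hΨ.exists_diffPoly hU
  obtain ⟨h', hh'⟩ := exists_apply_eval hU G ε h
  refine ⟨∑ i, g i * h' i, fun u => ?_⟩
  simp only [bracket, (hg u).varDeriv_eq, (hh u).varDeriv_eq, hh']
  simp only [eval_eq_jetEval, map_sum, map_mul]

lemma integral_pairing_smul_add {g h k : ℝ → I → ℝ} (hg : SmoothPeriodic g)
    (hh : SmoothPeriodic h) (hk : SmoothPeriodic k) (b c : ℝ) :
    ∫ x in (0 : ℝ)..1, ∑ i, (b • g + c • h) x i * k x i =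
      b * (∫ x in (0 : ℝ)..1, ∑ i, g x i * k x i) + c * ∫ x in (0 : ℝ)..1, ∑ i, h x i * k x i := by
  have hc : ∀ {g : ℝ → I → ℝ}, SmoothPeriodic g → Continuous fun x => ∑ i, g x i * k x i :=
    fun hg => continuous_finsetSum _ fun i _ =>
      (hg.contDiff_apply i).continuous.mul (hk.contDiff_apply i).continuous
  rw [← intervalIntegral.integral_const_mul, ← intervalIntegral.integral_const_mul,
    ← intervalIntegral.integral_add (((hc hg).const_mul b).intervalIntegrable _ _)
      (((hc hh).const_mul c).intervalIntegrable _ _)]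
  congr 1
  funext x
  rw [Finset.mul_sum, Finset.mul_sum, ← Finset.sum_add_distrib]
  exact Finset.sum_congr rfl fun i _ => by
    simp only [Pi.add_apply, Pi.smul_apply, smul_eq_mul]; ring

lemma bracket_smul_add_left (hU : IsOpen U) (ε : ℝ) (G : LocalOperator I I U) (c : ℝ)
    {Φ Φ' Ψ : Loop U → ℝ} (hΦ : IsLocalFunctional Φ) (hΦ' : IsLocalFunctional Φ')
    (hΨ : IsLocalFunctional Ψ) :
    bracket ε G (c • Φ + Φ') Ψ = c • bracket ε G Φ Ψ + bracket ε G Φ' Ψ := by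
  funext u
  have h1 := hΦ.hasVarDeriv hU u
  have h2 := hΦ'.hasVarDeriv hU u
  have h3 := smoothPeriodic_apply G ε u (hΨ.hasVarDeriv hU u).1
  have := integral_pairing_smul_add h2.1 h1.1 h3 1 c
  simp only [Pi.add_apply, Pi.smul_apply, smul_eq_mul, bracket]
  rw [(h1.smul_add hU c h2).varDeriv_eq, ← one_smul ℝ (varDeriv Φ' u), this, one_smul]
  ring

lemma bracket_smul_add_right (hU : IsOpen U) (ε : ℝ) (G : LocalOperator I I U) (c : ℝ)
    {Φ Ψ Ψ' : Loop U → ℝ} (hΦ : IsLocalFunctional Φ) (hΨ : IsLocalFunctional Ψ)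
    (hΨ' : IsLocalFunctional Ψ') :
    bracket ε G Φ (c • Ψ + Ψ') = c • bracket ε G Φ Ψ + bracket ε G Φ Ψ' := by
  funext u
  have h1 := hΨ.hasVarDeriv hU u
  have h2 := hΨ'.hasVarDeriv hU u
  have h3 := hΦ.hasVarDeriv hU u
  have := integral_pairing_smul_add (smoothPeriodic_apply G ε u h2.1)
    (smoothPeriodic_apply G ε u h1.1) h3.1 1 c
  simp only [mul_comm _ (varDeriv Φ u _ _)] at this
  simp only [Pi.add_apply, Pi.smul_apply, smul_eq_mul, bracket]
  rw [(h1.smul_add hU c h2).varDeriv_eq,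
    (isMatrixOperator_apply G ε).map_add_smul u h2.1.1 h1.1.1,
    ← one_smul ℝ (G.apply ε u (varDeriv Ψ' u)), this, one_smul]
  ring

lemma bracket_mul_left (hU : IsOpen U) (ε : ℝ) (G : LocalOperator I I U)
    {Φ Ψ Ω : Loop U → ℝ} (hΦ : IsLocalFunctional Φ) (hΨ : IsLocalFunctional Ψ)
    (hΩ : IsLocalFunctional Ω) :
    bracket ε G (Φ * Ψ) Ω = Φ * bracket ε G Ψ Ω + bracket ε G Φ Ω * Ψ := by
  funext u
  have h1 := hΦ.hasVarDeriv hU u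
  have h2 := hΨ.hasVarDeriv hU u
  have h3 := smoothPeriodic_apply G ε u (hΩ.hasVarDeriv hU u).1
  simp only [Pi.add_apply, Pi.mul_apply, bracket]
  rw [(h1.mul hU h2).varDeriv_eq, integral_pairing_smul_add h2.1 h1.1 h3]
  ring

end Brackets

/-! ### Skew-symmetry and the Jacobi identity by restriction from the ambient space -/

/-- The Dirac reduction of a local Poisson bracket is a local Poisson bracket. -/
lemma isLocalPoissonBracket_reduction {I K : Type} [Fintype I] [Fintype K] {U : Set (I ⊕ K → ℝ)}
    (hU : IsOpen U) {ε : ℝ} (hε : ε ≠ 0) {F : LocalOperator (I ⊕ K) (I ⊕ K) U}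
    (hF : IsLocalPoissonBracket ε F) {S : LocalOperator K K (slice U)}
    (hS : IsInverseOfMinor ε F S) {G : LocalOperator I I (slice U)}
    (hG : ∀ (w : Loop (slice U)) (ψ : ℝ → I → ℝ), SmoothPeriodic ψ →
      G.apply ε w ψ = (F.submatrix Sum.inl Sum.inl).apply ε (inclusion w) ψ -
        (F.submatrix Sum.inl Sum.inr).apply ε (inclusion w)
          (S.apply ε w ((F.submatrix Sum.inr Sum.inl).apply ε (inclusion w) ψ))) :
    IsLocalPoissonBracket ε G := by
  have hs := isOpen_slice (I := I) (K := K) hU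
  refine ⟨fun Φ Ψ hΦ hΨ => isLocalFunctional_bracket hs ε G hΦ hΨ,
    fun c Φ Φ' Ψ hΦ hΦ' hΨ => bracket_smul_add_left hs ε G c hΦ hΦ' hΨ,
    fun c Φ Ψ Ψ' hΦ hΨ hΨ' => bracket_smul_add_right hs ε G c hΦ hΨ hΨ', ?_,
    fun Φ Ψ Ω hΦ hΨ hΩ => bracket_mul_left hs ε G hΦ hΨ hΩ, ?_⟩
  · intro Φ Ψ hΦ hΨ
    funext w
    obtain ⟨V, hV, hw, H⟩ := exists_tangent_extension hU hε hS hG w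
    obtain ⟨Φ', hΦ', h1⟩ := H Φ hΦ
    obtain ⟨Ψ', hΨ', h2⟩ := H Ψ hΨ
    have := congrFun (hF.skew Φ' Ψ' hΦ' hΨ') (inclusion w)
    rwa [Pi.neg_apply, bracket_inclusion hU hV hΦ' (fun w hw => (h1 w hw).1) hw (h2 w hw).2,
      bracket_inclusion hU hV hΨ' (fun w hw => (h2 w hw).1) hw (h1 w hw).2] at this
  · intro Φ Ψ Ω hΦ hΨ hΩ
    funext w
    obtain ⟨V, hV, hw, H⟩ := exists_tangent_extension hU hε hS hG w
    choose! L hL h using H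
    -- The equality is needed at all loops in `V`, not only at the given one, because the outer
    -- bracket differentiates the inner one.
    have hb : ∀ {Θ Ξ}, IsLocalFunctional Θ → IsLocalFunctional Ξ →
        ∀ w : Loop (slice U), (∀ x, (inclusion w).1 x ∈ V) →
        bracket ε F (L Θ) (L Ξ) (inclusion w) = bracket ε G Θ Ξ w := fun hΘ hΞ w hw =>
      bracket_inclusion hU hV (hL _ hΘ) (fun w hw => (h _ hΘ w hw).1) hw (h _ hΞ w hw).2
    -- The inner ambient bracket need not have a tangent Hamiltonian field: as first argument it
    -- only has to be local and restrict correctly. Tangency is required of `L Λ` alone.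
    have hbb : ∀ {Θ Ξ Λ}, IsLocalFunctional Θ → IsLocalFunctional Ξ → IsLocalFunctional Λ →
        bracket ε F (bracket ε F (L Θ) (L Ξ)) (L Λ) (inclusion w) =
          bracket ε G (bracket ε G Θ Ξ) Λ w := fun hΘ hΞ hΛ =>
      bracket_inclusion hU hV (hF.isLocal _ _ (hL _ hΘ) (hL _ hΞ)) (hb hΘ hΞ) hw (h _ hΛ w hw).2
    have := congrFun (hF.jacobi _ _ _ (hL _ hΦ) (hL _ hΨ) (hL _ hΩ)) (inclusion w)
    simpa only [Pi.add_apply, Pi.zero_apply, hbb hΦ hΨ hΩ, hbb hΨ hΩ hΦ, hbb hΩ hΦ hΨ] using this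

end LocalPoisson

theorem proposition2p1 (m r : ℕ) (U : Set (Fin m ⊕ Fin r → ℝ)) (hU : IsOpen U)
    (ε : ℝ) (hε : ε ≠ 0)
    (F : LocalPoisson.LocalOperator (Fin m ⊕ Fin r) (Fin m ⊕ Fin r) U)
    (hF : LocalPoisson.IsLocalPoissonBracket ε F)
    (S : LocalPoisson.LocalOperator (Fin r) (Fin r) (LocalPoisson.slice U))
    (hS : LocalPoisson.IsInverseOfMinor ε F S) :
    ∃ G : LocalPoisson.LocalOperator (Fin m) (Fin m) (LocalPoisson.slice U),
      (∀ (w : LocalPoisson.Loop (LocalPoisson.slice U)) (ψ : ℝ → Fin m → ℝ),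
        LocalPoisson.SmoothPeriodic ψ →
        G.apply ε w ψ =
          (F.submatrix Sum.inl Sum.inl).apply ε (LocalPoisson.inclusion w) ψ -
          (F.submatrix Sum.inl Sum.inr).apply ε (LocalPoisson.inclusion w)
            (S.apply ε w
              ((F.submatrix Sum.inr Sum.inl).apply ε (LocalPoisson.inclusion w) ψ))) ∧
      LocalPoisson.IsDiracReduction ε F G ∧
      LocalPoisson.IsLocalPoissonBracket ε G := by
  obtain ⟨G, hG⟩ := LocalPoisson.exists_reducedOperator hU hε F S
  exact ⟨G, hG, LocalPoisson.isDiracReduction hU hS hG,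
    LocalPoisson.isLocalPoissonBracket_reduction hU hε hF hS hG⟩
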